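/- All manifolds and tensor fields are smooth ($C^\infty$). Let $n$ be a natural number. **Definitions.** A $2n$-dimensional *paraholomorphic paracomplex Riemannian (phpcR) manifold* $(N^{2n},P,h)$ is a $2n$-dimensional manifold $N$ with a Riemannian metric $h$ and a $(1,1)$-tensor field $P$ such that $P^2=\mathrm{id}$, the eigenvalues $+1$ and $-1$ of $P$ both have multiplicity $n$ at every point, $h(PX,PY)=h(X,Y)$, and $\nabla^h P=0$ for the Levi-Civita connection $\nabla^h$ of $h$. Its associated metric is $\widetilde h(X,Y)=h(X,PY)$. An *almost paracontact paracomplex Riemannian manifold* $(M^{2n+1},\phi,\xi,\eta,g)$ is a $(2n+1)$-dimensional manifold with a $(1,1)$-tensor field $\phi$, a vector field $\xi$, a $1$-form $\eta$ and a Riemannian metric $g$ such that $\phi^2=\mathrm{id}-\eta\otimes\xi$, $\eta(\xi)=1$, the eigenvalues $+1$ and $-1$ of $\phi$ on $\ker\eta$ both have multiplicity $n$, $g(x,\xi)=\eta(x)$ and $g(\phi x,\phi y)=g(x,y)-\eta(x)\eta(y)$. With $\nabla$ the Levi-Civita connection of $g$ and $F(x,y,z)=g\big((\nabla_x\phi)y,z\big)$,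 it is *para-Sasaki-like* if for all $X,Y,Z\in\ker\eta$ $$F(X,Y,Z)=F(\xi,Y,Z)=F(\xi,\xi,Z)=0,\qquad F(X,Y,\xi)=-g(X,Y).$$ **Theorem.** Let $(N^{2n},P,h)$ be a phpcR manifold. On $M^{2n+1}=\mathbb R\times N^{2n}$, with $t$ the coordinate of $\mathbb R$, put $$\eta=\mathrm dt,\qquad \xi=\tfrac{\partial}{\partial t},\qquad \phi\xi=0,\quad \phi|_{TN}=P,\qquad g=\mathrm dt^2+\cosh(2t)\,h+\sinh(2t)\,\widetilde h ,$$ where $TN=\ker\eta$. Then $g$ is a Riemannian metric and $(M,\phi,\xi,\eta,g)$ is a para-Sasaki-like Riemannian manifold. If moreover $(N,h)$ is complete, then $(M,g)$ is complete. (Complete means that every Cauchy sequence for the Riemannian distance converges; the distance between points of different components is infinite.) -/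

import Mathlib

open Bundle Manifold
open scoped ContDiff Topology ENNReal

noncomputable section

namespace ParaSasaki

section General

variable {E : Type*} [NormedAddCommGroup E] [NormedSpace ℝ E]
  {H : Type*} [TopologicalSpace H] {I : ModelWithCorners ℝ E H}
  {M : Type*} [TopologicalSpace M] [ChartedSpace H M] [IsManifold I ∞ M]

/-- Smoothness of a vector field. -/
def IsSmoothVectorField (Y : Π x : M, TangentSpace I x) : Prop :=
  ContMDiff I (I.prod 𝓘(ℝ, E)) ∞
    (fun x ↦ TotalSpace.mk' E (E := fun x : M ↦ TangentSpace I x) x (Y x))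

/-- Smoothness of a `1`-form. -/
def IsSmoothOneForm (η : Π x : M, TangentSpace I x →L[ℝ] ℝ) : Prop :=
  ContMDiff I (I.prod 𝓘(ℝ, E →L[ℝ] ℝ)) ∞ (fun x ↦ TotalSpace.mk' (E →L[ℝ] ℝ)
    (E := fun x : M ↦ TangentSpace I x →L[ℝ] Trivial M ℝ x) x (η x))

/-- Smoothness of a `(1,1)`-tensor field. -/
def IsSmoothEndomorphism (φ : Π x : M, TangentSpace I x →L[ℝ] TangentSpace I x) : Prop :=
  ContMDiff I (I.prod 𝓘(ℝ, E →L[ℝ] E)) ∞ (fun x ↦ TotalSpace.mk' (E →L[ℝ] E)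
    (E := fun x : M ↦ TangentSpace I x →L[ℝ] TangentSpace I x) x (φ x))

variable (I M) in
/-- Smooth Riemannian metrics on `M`. -/
abbrev RMetric := ContMDiffRiemannianMetric I ∞ E (fun x : M ↦ TangentSpace I x)

/-- The right-hand side of the Koszul formula. -/
def koszul (g : RMetric I M) (X Y Z : Π x : M, TangentSpace I x) (x : M) : ℝ :=
  mvfderiv I (fun y ↦ g.inner y (Y y) (Z y)) x (X x)
    + mvfderiv I (fun y ↦ g.inner y (Z y) (X y)) x (Y x)
    - mvfderiv I (fun y ↦ g.inner y (X y) (Y y)) x (Z x)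
    + g.inner x (VectorField.mlieBracket I X Y x) (Z x)
    + g.inner x (VectorField.mlieBracket I Z X x) (Y x)
    + g.inner x (VectorField.mlieBracket I Z Y x) (X x)

theorem mdifferentiableAt_metric (g : RMetric I M) {Y Z : Π x : M, TangentSpace I x} {x : M}
    (hY : MDiffAt (T% Y) x) (hZ : MDiffAt (T% Z) x) :
    MDiffAt (fun y ↦ g.inner y (Y y) (Z y)) x := by
  have : MDifferentiableAt I (I.prod 𝓘(ℝ))
      (fun m ↦ TotalSpace.mk' ℝ (E := Bundle.Trivial M ℝ) m (g.inner m (Y m) (Z m))) x := by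
    apply MDifferentiableAt.clm_bundle_apply₂ (F₁ := E) (F₂ := E)
    · exact g.contMDiff.mdifferentiableAt (by simp)
    · exact hY
    · exact hZ
  simp only [mdifferentiableAt_totalSpace] at this
  exact this.2

variable [FiniteDimensional ℝ E]

theorem koszul_tensorial_left (g : RMetric I M) {Y Z : Π x : M, TangentSpace I x} {x : M}
    (hY : MDiffAt (T% Y) x) (hZ : MDiffAt (T% Z) x) :
    TensorialAt I E (fun X ↦ koszul g X Y Z x) x where
  smul {f X} hf hX := by
    have h1 := mdifferentiableAt_metric g hZ hX
    have h2 := mdifferentiableAt_metric g hX hY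
    have e1 : (fun y ↦ g.inner y (Z y) ((f • X) y)) = f * (fun y ↦ g.inner y (Z y) (X y)) := by
      ext y; simp
    have e2 : (fun y ↦ g.inner y ((f • X) y) (Y y)) = f * (fun y ↦ g.inner y (X y) (Y y)) := by
      ext y; simp
    have s := g.symm x (Y x) (Z x)
    have s' := g.symm x (X x) (Z x)
    simp only [koszul, e1, e2, mvfderiv_mul hf h1, mvfderiv_mul hf h2,
      VectorField.mlieBracket_smul_left hf hX, VectorField.mlieBracket_smul_right hf hX]
    simp
    linear_combination (-(mvfderiv I f x (Y x))) * s'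
  add {X X'} hX hX' := by
    have h1 := mdifferentiableAt_metric g hZ hX
    have h1' := mdifferentiableAt_metric g hZ hX'
    have h2 := mdifferentiableAt_metric g hX hY
    have h2' := mdifferentiableAt_metric g hX' hY
    have e1 : (fun y ↦ g.inner y (Z y) ((X + X') y))
        = (fun y ↦ g.inner y (Z y) (X y)) + (fun y ↦ g.inner y (Z y) (X' y)) := by
      ext y; simp
    have e2 : (fun y ↦ g.inner y ((X + X') y) (Y y))
        = (fun y ↦ g.inner y (X y) (Y y)) + (fun y ↦ g.inner y (X' y) (Y y)) := by
      ext y; simp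
    simp only [koszul, e1, e2, mvfderiv_add h1 h1', mvfderiv_add h2 h2',
      VectorField.mlieBracket_add_left hX hX', VectorField.mlieBracket_add_right hX hX']
    simp
    ring

theorem koszul_tensorial_right (g : RMetric I M) {X Y : Π x : M, TangentSpace I x} {x : M}
    (hX : MDiffAt (T% X) x) (hY : MDiffAt (T% Y) x) :
    TensorialAt I E (fun Z ↦ koszul g X Y Z x) x where
  smul {f Z} hf hZ := by
    have h1 := mdifferentiableAt_metric g hY hZ
    have h2 := mdifferentiableAt_metric g hZ hX
    have e1 : (fun y ↦ g.inner y (Y y) ((f • Z) y)) = f * (fun y ↦ g.inner y (Y y) (Z y)) := by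
      ext y; simp
    have e2 : (fun y ↦ g.inner y ((f • Z) y) (X y)) = f * (fun y ↦ g.inner y (Z y) (X y)) := by
      ext y; simp
    have s := g.symm x (Y x) (Z x)
    have s' := g.symm x (X x) (Y x)
    simp only [koszul, e1, e2, mvfderiv_mul hf h1, mvfderiv_mul hf h2,
      VectorField.mlieBracket_smul_left hf hZ]
    simp
    linear_combination (mvfderiv I f x (X x)) * s
  add {Z Z'} hZ hZ' := by
    have h1 := mdifferentiableAt_metric g hY hZ
    have h1' := mdifferentiableAt_metric g hY hZ'
    have h2 := mdifferentiableAt_metric g hZ hX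
    have h2' := mdifferentiableAt_metric g hZ' hX
    have e1 : (fun y ↦ g.inner y (Y y) ((Z + Z') y))
        = (fun y ↦ g.inner y (Y y) (Z y)) + (fun y ↦ g.inner y (Y y) (Z' y)) := by
      ext y; simp
    have e2 : (fun y ↦ g.inner y ((Z + Z') y) (X y))
        = (fun y ↦ g.inner y (Z y) (X y)) + (fun y ↦ g.inner y (Z' y) (X y)) := by
      ext y; simp
    simp only [koszul, e1, e2, mvfderiv_add h1 h1', mvfderiv_add h2 h2',
      VectorField.mlieBracket_add_left hZ hZ']
    simp
    ring

theorem koszul_add_middle (g : RMetric I M) {X Y Y' Z : Π x : M, TangentSpace I x} {x : M}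
    (hX : MDiffAt (T% X) x) (hY : MDiffAt (T% Y) x) (hY' : MDiffAt (T% Y') x)
    (hZ : MDiffAt (T% Z) x) :
    koszul g X (Y + Y') Z x = koszul g X Y Z x + koszul g X Y' Z x := by
  have h1 := mdifferentiableAt_metric g hY hZ
  have h1' := mdifferentiableAt_metric g hY' hZ
  have h2 := mdifferentiableAt_metric g hX hY
  have h2' := mdifferentiableAt_metric g hX hY'
  have e1 : (fun y ↦ g.inner y ((Y + Y') y) (Z y))
      = (fun y ↦ g.inner y (Y y) (Z y)) + (fun y ↦ g.inner y (Y' y) (Z y)) := by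
    ext y; simp
  have e2 : (fun y ↦ g.inner y (X y) ((Y + Y') y))
      = (fun y ↦ g.inner y (X y) (Y y)) + (fun y ↦ g.inner y (X y) (Y' y)) := by
    ext y; simp
  simp only [koszul, e1, e2, mvfderiv_add h1 h1', mvfderiv_add h2 h2',
    VectorField.mlieBracket_add_right hY hY']
  simp
  ring

theorem koszul_smul_middle (g : RMetric I M) {f : M → ℝ} {X Y Z : Π x : M, TangentSpace I x}
    {x : M} (hf : MDiffAt f x) (hX : MDiffAt (T% X) x) (hY : MDiffAt (T% Y) x)
    (hZ : MDiffAt (T% Z) x) :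
    koszul g X (f • Y) Z x
      = f x * koszul g X Y Z x + 2 * (mvfderiv I f x (X x) * g.inner x (Y x) (Z x)) := by
  have h1 := mdifferentiableAt_metric g hY hZ
  have h2 := mdifferentiableAt_metric g hX hY
  have e1 : (fun y ↦ g.inner y ((f • Y) y) (Z y)) = f * (fun y ↦ g.inner y (Y y) (Z y)) := by
    ext y; simp
  have e2 : (fun y ↦ g.inner y (X y) ((f • Y) y)) = f * (fun y ↦ g.inner y (X y) (Y y)) := by
    ext y; simp
  have s := g.symm x (X x) (Y x)
  simp only [koszul, e1, e2, mvfderiv_mul hf h1, mvfderiv_mul hf h2,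
    VectorField.mlieBracket_smul_right hf hY]
  simp
  linear_combination (-(mvfderiv I f x (Z x))) * s

/-- The bilinear form `(u, w) ↦ 2 g(∇_u Y, w)` at a point where `Y` is differentiable. -/
def koszulForm (g : RMetric I M) (Y : Π x : M, TangentSpace I x) (x : M)
    (hY : MDiffAt (T% Y) x) : TangentSpace I x →L[ℝ] TangentSpace I x →L[ℝ] ℝ :=
  TensorialAt.mkHom₂ (fun X Z ↦ koszul g X Y Z x) x
    (fun _ hZ ↦ koszul_tensorial_left g hY hZ) (fun _ hX ↦ koszul_tensorial_right g hX hY)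

theorem isInvertible_of_injective {V : Type*} [NormedAddCommGroup V] [NormedSpace ℝ V]
    [FiniteDimensional ℝ V] (B : V →L[ℝ] V →L[ℝ] ℝ) (hB : Function.Injective B) :
    B.IsInvertible := by
  have hd : Module.finrank ℝ V = Module.finrank ℝ (V →L[ℝ] ℝ) := by
    rw [← (LinearMap.toContinuousLinearMap (𝕜 := ℝ) (E := V) (F' := ℝ)).finrank_eq]
    exact (Subspace.dual_finrank_eq (K := ℝ) (V := V)).symm
  exact ⟨(LinearEquiv.ofInjectiveOfFinrankEq B.toLinearMap hB hd).toContinuousLinearEquiv,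
    by ext; rfl⟩

/-- The metric, as a map from tangent vectors to covectors, is invertible. -/
theorem isInvertible_inner (g : RMetric I M) (x : M) : (g.inner x).IsInvertible := by
  have inj : Function.Injective (g.inner x) := by
    rw [injective_iff_map_eq_zero]
    intro v hv
    by_contra h
    have := g.pos x v h
    simp [hv] at this
  exact isInvertible_of_injective (V := E) (g.inner x) inj

open Classical in
/-- The operator `∇_u Y`, defined by `2 g(∇_u Y, w) = koszul g X Y Z x` where `X x = u`, `Z x = w`.
The order of arguments is `leviCivitaFun g Y x u = (∇_u Y)(x)`; on vector fields that are not
differentiable at `x` it takes the junk value `0`. -/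
def leviCivitaFun (g : RMetric I M) (Y : Π x : M, TangentSpace I x) (x : M) :
    TangentSpace I x →L[ℝ] TangentSpace I x :=
  if hY : MDiffAt (T% Y) x then
    (2⁻¹ : ℝ) • (g.inner x).inverse ∘L koszulForm g Y x hY else 0

/-- The Koszul formula. -/
theorem inner_leviCivitaFun (g : RMetric I M) {X Y Z : Π x : M, TangentSpace I x} {x : M}
    (hX : MDiffAt (T% X) x) (hY : MDiffAt (T% Y) x) (hZ : MDiffAt (T% Z) x) :
    2 * g.inner x (leviCivitaFun g Y x (X x)) (Z x) = koszul g X Y Z x := by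
  have h := (isInvertible_inner g x).self_apply_inverse (koszulForm g Y x hY (X x))
  have h2 : koszulForm g Y x hY (X x) (Z x) = koszul g X Y Z x :=
    TensorialAt.mkHom₂_apply _ _ hX hZ
  simp [leviCivitaFun, hY, h, h2]

theorem leviCivitaFun_ext (g : RMetric I M) {x : M} {A B : TangentSpace I x →L[ℝ] TangentSpace I x}
    (h : ∀ X Z : Π x : M, TangentSpace I x, MDiffAt (T% X) x → MDiffAt (T% Z) x →
      2 * g.inner x (A (X x)) (Z x) = 2 * g.inner x (B (X x)) (Z x)) : A = B := by
  ext1 u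
  apply (isInvertible_inner g x).injective
  ext1 w
  have := h (FiberBundle.extend E u) (FiberBundle.extend E w)
    (FiberBundle.mdifferentiableAt_extend ..) (FiberBundle.mdifferentiableAt_extend ..)
  simpa using this

/-- The Levi-Civita connection of `g`. The order of arguments is
`leviCivita g Y x u = (∇_u Y)(x)`. -/
def leviCivita (g : RMetric I M) : CovariantDerivative I E (fun x : M ↦ TangentSpace I x) where
  toFun := leviCivitaFun g
  isCovariantDerivativeOnUniv :=
    { add := by
        intro Y Y' x hY hY' _
        refine leviCivitaFun_ext g fun X Z hX hZ ↦ ?_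
        have hYY : MDiffAt (T% (Y + Y')) x := mdifferentiableAt_add_section hY hY'
        have e := inner_leviCivitaFun g hX hYY hZ
        rw [koszul_add_middle g hX hY hY' hZ, ← inner_leviCivitaFun g hX hY hZ,
          ← inner_leviCivitaFun g hX hY' hZ] at e
        rw [e]
        simp
        ring
      leibniz := by
        intro Y f x hY hf _
        refine leviCivitaFun_ext g fun X Z hX hZ ↦ ?_
        have hfY : MDiffAt (T% (f • Y)) x := hf.smul_section hY
        have e := inner_leviCivitaFun g hX hfY hZ
        rw [koszul_smul_middle g hf hX hY hZ, ← inner_leviCivitaFun g hX hY hZ] at e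
        rw [e]
        simp
        ring }

/-- The Levi-Civita connection is compatible with the metric. -/
theorem leviCivita_metric (g : RMetric I M) {X Y Z : Π x : M, TangentSpace I x} {x : M}
    (hX : MDiffAt (T% X) x) (hY : MDiffAt (T% Y) x) (hZ : MDiffAt (T% Z) x) :
    mvfderiv I (fun y ↦ g.inner y (Y y) (Z y)) x (X x) =
     g.inner x (leviCivita g Y x (X x)) (Z x) + g.inner x (Y x) (leviCivita g Z x (X x)) := by
  have a := inner_leviCivitaFun g hX hY hZ
  have b := inner_leviCivitaFun g hX hZ hY
  change _ = g.inner x (leviCivitaFun g Y x (X x)) (Z x)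
    + g.inner x (Y x) (leviCivitaFun g Z x (X x))
  rw [g.symm x (Y x) _]
  have sf : ∀ A B : Π x : M, TangentSpace I x,
      (fun y ↦ g.inner y (A y) (B y)) = fun y ↦ g.inner y (B y) (A y) := by
    intro A B; ext y; exact g.symm _ _ _
  simp only [koszul] at a b
  rw [sf Z Y, sf Y X, VectorField.mlieBracket_swap_apply (V := X) (W := Z),
    VectorField.mlieBracket_swap_apply (V := Y) (W := Z)] at b
  rw [sf Z X] at a
  rw [VectorField.mlieBracket_swap_apply (V := X) (W := Y)] at a
  have := g.symm x (Z x) (VectorField.mlieBracket I Y X x)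
  simp at a b
  linarith

/-- The Levi-Civita connection is torsion-free. -/
theorem leviCivita_torsion (g : RMetric I M) : (leviCivita g).torsion = 0 := by
  rw [CovariantDerivative.torsion_eq_zero_iff]
  intro X Y x hX hY
  change leviCivitaFun g Y x (X x) - leviCivitaFun g X x (Y x) = _
  apply (isInvertible_inner g x).injective
  ext1 w
  have hZ := FiberBundle.mdifferentiableAt_extend I E w
  have a := inner_leviCivitaFun g hX hY hZ
  have b := inner_leviCivitaFun g hY hX hZ
  have sf : ∀ A B : Π x : M, TangentSpace I x,
      (fun y ↦ g.inner y (A y) (B y)) = fun y ↦ g.inner y (B y) (A y) := by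
    intro A B; ext y; exact g.symm _ _ _
  simp only [koszul] at a b
  rw [VectorField.mlieBracket_swap_apply (V := Y) (W := X)] at b
  rw [sf (FiberBundle.extend E w) X] at a
  rw [sf (FiberBundle.extend E w) Y, sf Y X] at b
  simp at a b ⊢
  linarith

/-- The covariant derivative `(∇_u φ) Y = ∇_u (φ Y) - φ (∇_u Y)` at `x` of a `(1,1)`-tensor
field. -/
def nablaEnd (g : RMetric I M) (φ : Π x : M, TangentSpace I x →L[ℝ] TangentSpace I x)
    (x : M) (u : TangentSpace I x) (Y : Π x : M, TangentSpace I x) : TangentSpace I x :=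
  leviCivita g (fun y ↦ φ y (Y y)) x u - φ x (leviCivita g Y x u)

/-- The tensor `F(u, Y, w) = g((∇_u φ) Y, w)` at `x`; for `φ` and `Y`
differentiable at `x` it depends on `Y` only through `Y x`. -/
def structureTensor (g : RMetric I M) (φ : Π x : M, TangentSpace I x →L[ℝ] TangentSpace I x)
    (x : M) (u : TangentSpace I x) (Y : Π x : M, TangentSpace I x) (w : TangentSpace I x) : ℝ :=
  g.inner x (nablaEnd g φ x u Y) w

/-- `(M, P, h)` is a paraholomorphic paracomplex Riemannian manifold of dimension `2n`: `P` is an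
almost product structure whose eigenvalues `1` and `-1` both have multiplicity `n` at every point,
it is an isometry of `h`, and it is parallel for the Levi-Civita connection of `h`. -/
structure IsParaholomorphic (n : ℕ)
    (P : Π x : M, TangentSpace I x →L[ℝ] TangentSpace I x) (h : RMetric I M) : Prop where
  smooth : IsSmoothEndomorphism P
  sq : ∀ x u, P x (P x u) = u
  finrank_pos : ∀ x, Module.finrank ℝ (Module.End.eigenspace (P x).toLinearMap 1) = n
  finrank_neg : ∀ x, Module.finrank ℝ (Module.End.eigenspace (P x).toLinearMap (-1)) = n
  isometry : ∀ x u v, h.inner x (P x u) (P x v) = h.inner x u v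
  parallel : ∀ x u Y, MDiffAt (T% Y) x → nablaEnd h P x u Y = 0

/-- `(M, φ, ξ, η, g)` is an almost paracontact paracomplex Riemannian manifold of dimension
`2n + 1`. The eigenvalues `1` and `-1` of `φ` on the distribution `ker η` both have
multiplicity `n`. -/
structure IsAlmostParacontactParacomplex (n : ℕ)
    (φ : Π x : M, TangentSpace I x →L[ℝ] TangentSpace I x) (ξ : Π x : M, TangentSpace I x)
    (η : Π x : M, TangentSpace I x →L[ℝ] ℝ) (g : RMetric I M) : Prop where
  smooth_phi : IsSmoothEndomorphism φ
  smooth_xi : IsSmoothVectorField ξ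
  smooth_eta : IsSmoothOneForm η
  sq : ∀ x u, φ x (φ x u) = u - η x u • ξ x
  eta_xi : ∀ x, η x (ξ x) = 1
  finrank_pos : ∀ x, Module.finrank ℝ
    (Module.End.eigenspace (φ x).toLinearMap 1 ⊓ (η x).toLinearMap.ker :
      Submodule ℝ (TangentSpace I x)) = n
  finrank_neg : ∀ x, Module.finrank ℝ
    (Module.End.eigenspace (φ x).toLinearMap (-1) ⊓ (η x).toLinearMap.ker :
      Submodule ℝ (TangentSpace I x)) = n
  inner_xi : ∀ x u, g.inner x u (ξ x) = η x u
  inner_phi : ∀ x u v, g.inner x (φ x u) (φ x v) = g.inner x u v - η x u * η x v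

/-- Para-Sasaki-like Riemannian manifolds: for horizontal `X, Y, Z` (vectors in `ker η`),
`F(X, Y, Z) = F(ξ, Y, Z) = F(ξ, ξ, Z) = 0` and `F(X, Y, ξ) = - g(X, Y)`. -/
structure IsParaSasakiLike (n : ℕ)
    (φ : Π x : M, TangentSpace I x →L[ℝ] TangentSpace I x) (ξ : Π x : M, TangentSpace I x)
    (η : Π x : M, TangentSpace I x →L[ℝ] ℝ) (g : RMetric I M) : Prop extends
    IsAlmostParacontactParacomplex n φ ξ η g where
  horizontal : ∀ x u Y w, MDiffAt (T% Y) x → η x u = 0 → η x (Y x) = 0 → η x w = 0 →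
    structureTensor g φ x u Y w = 0
  xi_horizontal : ∀ x Y w, MDiffAt (T% Y) x → η x (Y x) = 0 → η x w = 0 →
    structureTensor g φ x (ξ x) Y w = 0
  xi_xi : ∀ x w, η x w = 0 → structureTensor g φ x (ξ x) ξ w = 0
  horizontal_xi : ∀ x u Y, MDiffAt (T% Y) x → η x u = 0 → η x (Y x) = 0 →
    structureTensor g φ x u Y (ξ x) = - g.inner x u (Y x)

/-- Completeness of a Riemannian metric: every Cauchy sequence for the Riemannian distance (the
infimum of the lengths of `C^1` paths, infinite between different components) converges. -/
def IsCompleteMetric (g : RMetric I M) : Prop :=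
  letI : RiemannianBundle (fun x : M ↦ TangentSpace I x) := ⟨g.toRiemannianMetric⟩
  ∀ p : ℕ → M,
    (∀ ε : ℝ≥0∞, 0 < ε → ∃ m₀, ∀ m ≥ m₀, ∀ k ≥ m₀, riemannianEDist I (p m) (p k) < ε) →
    ∃ q : M, Filter.Tendsto (fun m ↦ riemannianEDist I (p m) q) Filter.atTop (𝓝 0)

end General

section HyperbolicExtension

variable {E : Type*} [NormedAddCommGroup E] [NormedSpace ℝ E]
  {H : Type*} [TopologicalSpace H] {I : ModelWithCorners ℝ E H}
  {N : Type*} [TopologicalSpace N] [ChartedSpace H N] [IsManifold I ∞ N]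

/-- The `1`-form `η = dt` on `ℝ × N`. -/
def etaExt (x : ℝ × N) : TangentSpace (𝓘(ℝ).prod I) x →L[ℝ] ℝ :=
  mvfderiv (𝓘(ℝ).prod I) (Prod.fst : ℝ × N → ℝ) x

/-- The projection `T_(t,p) (ℝ × N) → T_p N`. -/
def projN (x : ℝ × N) : TangentSpace (𝓘(ℝ).prod I) x →L[ℝ] TangentSpace I x.2 :=
  mfderiv (𝓘(ℝ).prod I) I (Prod.snd : ℝ × N → N) x

/-- The inclusion `T_p N → T_(t,p) (ℝ × N)` as vectors tangent to the slice `{t} × N`. -/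
def inclN (x : ℝ × N) : TangentSpace I x.2 →L[ℝ] TangentSpace (𝓘(ℝ).prod I) x :=
  mfderiv I (𝓘(ℝ).prod I) (fun p : N ↦ (x.1, p)) x.2

/-- The vector field `ξ = ∂/∂t` on `ℝ × N`. -/
def xiExt (x : ℝ × N) : TangentSpace (𝓘(ℝ).prod I) x :=
  mfderiv 𝓘(ℝ) (𝓘(ℝ).prod I) (fun t : ℝ ↦ (t, x.2)) x.1 (1 : ℝ)

/-- The endomorphism `φ` of `T (ℝ × N)` that is `P` on `TN = ker dt` and vanishes on `∂/∂t`. -/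
def phiExt (P : Π p : N, TangentSpace I p →L[ℝ] TangentSpace I p) (x : ℝ × N) :
    TangentSpace (𝓘(ℝ).prod I) x →L[ℝ] TangentSpace (𝓘(ℝ).prod I) x :=
  inclN x ∘L P x.2 ∘L projN x

/-- The form `dt² + cosh(2t) h + sinh(2t) h̃` on `ℝ × N`, where `h̃(X, Y) = h(X, PY)`. -/
def metricExt (P : Π p : N, TangentSpace I p →L[ℝ] TangentSpace I p) (h : RMetric I N)
    (x : ℝ × N) (u v : TangentSpace (𝓘(ℝ).prod I) x) : ℝ :=
  etaExt x u * etaExt x v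
    + Real.cosh (2 * x.1) * h.inner x.2 (projN x u) (projN x v)
    + Real.sinh (2 * x.1) * h.inner x.2 (projN x u) (P x.2 (projN x v))

end HyperbolicExtension

end ParaSasaki

end

/-! Write `T(ℝ × N) = ℝξ ⊕ TN`. An isometric involution `P` is `h`-symmetric, so its `±1`
eigenspaces are orthogonal, and the slice metric `g_t = cosh(2t) h + sinh(2t) h̃` is `e^{2t} h` on
the first and `e^{-2t} h` on the second. Hence `e^{-2|t|} h ≤ g_t ≤ e^{2|t|} h`
(`cosh_add_sinh_mul_bounds`), which gives positivity and later controls distances.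

For the structure equations it suffices to use lifts `bξ + Y` with `b` constant and `Y` a field on
`N`, since `∇φ` is tensorial and lifts realise every tangent vector. Brackets of lifts are lifts of
brackets (`mlieBracket_liftField`), and `∂_t g_t(X, Y) = 2 g_t(X, PY)`. With `∇^h P = 0` the Koszul
formula gives, for `u = aξ + X`, `∇_u(bξ + Y) = ∇^h_X Y + a PY + b PX - g_t(X, PY) ξ`
(`leviCivita_liftField`). Hence, for any field `Y`, `(∇_u φ)Y = -η(Y) X - g_t(X, Y_N) ξ`, where
`Y_N` is the `TN` part of `Y` (`nablaEnd_phiExt`), and the para-Sasaki-like conditions are read off.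

For completeness, `t` is 1-Lipschitz, so along a Cauchy sequence it converges to some `T` and is
bounded by some `R`. A path of length at most `1` starting in `|t| ≤ R` stays in `|t| ≤ R + 1`,
where the projection to `N` stretches lengths by at most `e^{R+1}` (`metricEDist_snd_le`). So the
`N` components are Cauchy and converge to some `q`; a vertical move followed by a horizontal one
shows that the sequence tends to `(T, q)`. -/

noncomputable section

namespace ParaSasaki

/-! ### Smoothness criterion for sections of homomorphism bundles -/

section HomBundle

variable {n : WithTop ℕ∞} {B F₁ F₂ : Type*} {E₁ : B → Type*} {E₂ : B → Type*}
  [∀ x, AddCommGroup (E₁ x)] [∀ x, Module ℝ (E₁ x)] [NormedAddCommGroup F₁] [NormedSpace ℝ F₁]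
  [TopologicalSpace (TotalSpace F₁ E₁)] [∀ x, TopologicalSpace (E₁ x)] [∀ x, AddCommGroup (E₂ x)]
  [∀ x, Module ℝ (E₂ x)] [NormedAddCommGroup F₂] [NormedSpace ℝ F₂]
  [TopologicalSpace (TotalSpace F₂ E₂)] [∀ x, TopologicalSpace (E₂ x)]
  {EB : Type*} [NormedAddCommGroup EB] [NormedSpace ℝ EB] {HB : Type*} [TopologicalSpace HB]
  {IB : ModelWithCorners ℝ EB HB} [TopologicalSpace B] [ChartedSpace HB B]
  [FiberBundle F₁ E₁] [VectorBundle ℝ F₁ E₁] [FiberBundle F₂ E₂] [VectorBundle ℝ F₂ E₂]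
  [∀ x, IsTopologicalAddGroup (E₂ x)] [∀ x, ContinuousSMul ℝ (E₂ x)]

/-- In a finite basis `b`, `f = ∑ bᵢ* ⊗ f(bᵢ)`, a finite sum of smooth maps followed by continuous
linear ones. -/
theorem contMDiffAt_clm_of_apply [FiniteDimensional ℝ F₁] {f : B → F₁ →L[ℝ] F₂} {x : B}
    (h : ∀ v, ContMDiffAt IB 𝓘(ℝ, F₂) n (fun y ↦ f y v) x) :
    ContMDiffAt IB 𝓘(ℝ, F₁ →L[ℝ] F₂) n f x := by
  let b := Module.finBasis ℝ F₁
  have e : f = fun y ↦ ∑ i, ContinuousLinearMap.smulRightL ℝ F₁ F₂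
      (LinearMap.toContinuousLinearMap (b.coord i)) (f y (b i)) := by
    ext y v
    simp only [sum_apply, ContinuousLinearMap.smulRightL_apply_apply,
      ContinuousLinearMap.smulRight_apply, LinearMap.coe_toContinuousLinearMap', b.coord_apply]
    conv_lhs => rw [← b.sum_repr v, map_sum]
    simp only [map_smul]
  rw [e]
  refine contMDiffAt_finsetSum fun i _ ↦ ?_
  exact (ContinuousLinearMap.contMDiff _).contMDiffAt.comp x (h (b i))

/-- A section of the bundle of homomorphisms is smooth if it maps local smooth sections to local
smooth sections. -/
theorem contMDiffAt_hom_of_apply [FiniteDimensional ℝ F₁]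
    [ContMDiffVectorBundle n F₁ E₁ IB] [ContMDiffVectorBundle n F₂ E₂ IB]
    {φ : Π x, E₁ x →L[ℝ] E₂ x} {x : B}
    (h : ∀ σ : Π x, E₁ x, ContMDiffAt IB (IB.prod 𝓘(ℝ, F₁)) n (fun y ↦ TotalSpace.mk' F₁ y (σ y)) x →
      ContMDiffAt IB (IB.prod 𝓘(ℝ, F₂)) n (fun y ↦ TotalSpace.mk' F₂ y (φ y (σ y))) x) :
    ContMDiffAt IB (IB.prod 𝓘(ℝ, F₁ →L[ℝ] F₂)) n
      (fun y ↦ TotalSpace.mk' (F₁ →L[ℝ] F₂) (E := fun y ↦ E₁ y →L[ℝ] E₂ y) y (φ y)) x := by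
  rw [contMDiffAt_hom_bundle]
  refine ⟨contMDiffAt_id, contMDiffAt_clm_of_apply fun v ↦ ?_⟩
  have hx := FiberBundle.mem_baseSet_trivializationAt F₁ E₁ x
  have hx₂ := FiberBundle.mem_baseSet_trivializationAt F₂ E₂ x
  -- The test section is constant, equal to `v`, in the trivialization at `x`. Its image under `φ`,
  -- read in the second trivialization, is the coordinate expression of `φ` applied to `v`.
  have hs : ContMDiffAt IB (IB.prod 𝓘(ℝ, F₁)) n
      (fun y ↦ TotalSpace.mk' F₁ y ((trivializationAt F₁ E₁ x).symmL ℝ y v)) x := by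
    rw [contMDiffAt_totalSpace]
    refine ⟨contMDiffAt_id, contMDiffAt_const (c := v) |>.congr_of_eventuallyEq ?_⟩
    filter_upwards [(trivializationAt F₁ E₁ x).open_baseSet.mem_nhds hx] with y hy
    simp [Trivialization.symmL_apply _ hy, hy]
  have := (contMDiffAt_totalSpace.1 (h _ hs)).2
  refine this.congr_of_eventuallyEq ?_
  filter_upwards [(trivializationAt F₂ E₂ x).open_baseSet.mem_nhds hx₂] with y hy
  simp [ContinuousLinearMap.inCoordinates, Trivialization.coe_linearMapAt_of_mem _ hy]

end HomBundle

/-! ### The splitting of the tangent bundle of `ℝ × N`, and smoothness of `ξ`, `η`, `φ`, `g` -/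

section Product

variable {E : Type*} [NormedAddCommGroup E] [NormedSpace ℝ E]
  {H : Type*} [TopologicalSpace H] {I : ModelWithCorners ℝ E H}
  {N : Type*} [TopologicalSpace N] [ChartedSpace H N]

theorem etaExt_apply (x : ℝ × N) (u : TangentSpace (𝓘(ℝ).prod I) x) :
    etaExt x u = u.1 := by
  simp only [etaExt, mvfderiv, mfderiv_fst]
  rfl

theorem projN_apply (x : ℝ × N) (u : TangentSpace (𝓘(ℝ).prod I) x) :
    projN x u = u.2 := by
  simp only [projN, mfderiv_snd]
  rfl

theorem inclN_apply (x : ℝ × N) (v : TangentSpace I x.2) :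
    inclN x v = ((0, v) : ℝ × E) := by
  simp only [inclN, mfderiv_prod_right]
  rfl

variable (I) in
theorem xiExt_eq (x : ℝ × N) : xiExt (I := I) x = ((1, 0) : ℝ × E) := by
  simp only [xiExt, mfderiv_prod_left]
  rfl

@[simp] theorem etaExt_inclN (x : ℝ × N) (v : TangentSpace I x.2) : etaExt x (inclN x v) = 0 := by
  rw [etaExt_apply, inclN_apply]

@[simp] theorem etaExt_xiExt (x : ℝ × N) : etaExt (I := I) x (xiExt x) = 1 := by
  rw [etaExt_apply, xiExt_eq]

@[simp] theorem projN_inclN (x : ℝ × N) (v : TangentSpace I x.2) : projN x (inclN x v) = v := by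
  rw [projN_apply, inclN_apply]

@[simp] theorem projN_xiExt (x : ℝ × N) : projN (I := I) x (xiExt x) = 0 := by
  rw [projN_apply, xiExt_eq]
  rfl

theorem eq_smul_xiExt_add_inclN (x : ℝ × N) (u : TangentSpace (𝓘(ℝ).prod I) x) :
    u = etaExt x u • xiExt x + inclN x (projN x u) := by
  rw [etaExt_apply, xiExt_eq, inclN_apply, projN_apply]
  refine Prod.ext (α := ℝ) (β := E) ?_ ?_
  · change u.1 = u.1 * 1 + 0
    simp
  · change u.2 = u.1 • (0 : E) + u.2
    simp

theorem eq_inclN_of_etaExt_eq_zero {x : ℝ × N} {u : TangentSpace (𝓘(ℝ).prod I) x}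
    (hu : etaExt x u = 0) : u = inclN x (projN x u) := by
  conv_lhs => rw [eq_smul_xiExt_add_inclN x u, hu, zero_smul, zero_add]

@[simp] theorem phiExt_inclN (P : Π p : N, TangentSpace I p →L[ℝ] TangentSpace I p) (x : ℝ × N)
    (v : TangentSpace I x.2) : phiExt P x (inclN x v) = inclN x (P x.2 v) := by
  simp [phiExt]

@[simp] theorem phiExt_xiExt (P : Π p : N, TangentSpace I p →L[ℝ] TangentSpace I p) (x : ℝ × N) :
    phiExt P x (xiExt x) = 0 := by
  simp [phiExt]

variable [IsManifold I ∞ N]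

/-- The result is a vector field along `Prod.snd`, not a section over `ℝ × N`. In this form `P` and
`h` apply to it by composition, without pullback bundles. -/
theorem contMDiffAt_projN {σ : Π x : ℝ × N, TangentSpace (𝓘(ℝ).prod I) x} {x : ℝ × N}
    (hσ : ContMDiffAt (𝓘(ℝ).prod I) ((𝓘(ℝ).prod I).prod 𝓘(ℝ, ℝ × E)) ∞
      (fun y ↦ TotalSpace.mk' (ℝ × E) (E := fun y : ℝ × N ↦ TangentSpace (𝓘(ℝ).prod I) y)
        y (σ y)) x) :
    ContMDiffAt (𝓘(ℝ).prod I) (I.prod 𝓘(ℝ, E)) ∞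
      (fun y ↦ TotalSpace.mk' E (E := fun p : N ↦ TangentSpace I p) y.2 (projN y (σ y))) x := by
  have h : ContMDiff (𝓘(ℝ).prod I).tangent I.tangent ∞
      (tangentMap (𝓘(ℝ).prod I) I (Prod.snd : ℝ × N → N)) :=
    contMDiff_snd.contMDiff_tangentMap (n := ∞) (by simp)
  exact h.contMDiffAt.comp x hσ

theorem contMDiff_zeroTangent : ContMDiff 𝓘(ℝ) 𝓘(ℝ).tangent ∞
    (fun t : ℝ ↦ TotalSpace.mk' ℝ (E := fun t : ℝ ↦ TangentSpace 𝓘(ℝ) t) t (0 : ℝ)) :=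
  Bundle.contMDiff_zeroSection ℝ (fun t : ℝ ↦ TangentSpace 𝓘(ℝ) t)

theorem contMDiffAt_inclN {v : Π x : ℝ × N, TangentSpace I x.2} {x : ℝ × N}
    (hv : ContMDiffAt (𝓘(ℝ).prod I) (I.prod 𝓘(ℝ, E)) ∞
      (fun y ↦ TotalSpace.mk' E (E := fun p : N ↦ TangentSpace I p) y.2 (v y)) x) :
    ContMDiffAt (𝓘(ℝ).prod I) ((𝓘(ℝ).prod I).prod 𝓘(ℝ, ℝ × E)) ∞
      (fun y ↦ TotalSpace.mk' (ℝ × E) (E := fun y : ℝ × N ↦ TangentSpace (𝓘(ℝ).prod I) y)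
        y (inclN y (v y))) x := by
  have h := (contMDiff_equivTangentBundleProd_symm (I := 𝓘(ℝ)) (M := ℝ) (I' := I) (M' := N)
    (n := ∞)).contMDiffAt.comp x
      ((contMDiff_zeroTangent.contMDiffAt.comp x contMDiffAt_fst).prodMk hv)
  refine h.congr_of_eventuallyEq (.of_forall fun y ↦ ?_)
  simp only [inclN_apply]
  rfl

theorem mdifferentiableAt_inclN {v : Π x : ℝ × N, TangentSpace I x.2} {x : ℝ × N}
    (hv : MDifferentiableAt (𝓘(ℝ).prod I) (I.prod 𝓘(ℝ, E))
      (fun y ↦ TotalSpace.mk' E (E := fun p : N ↦ TangentSpace I p) y.2 (v y)) x) :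
    MDiffAt (T% (fun y ↦ inclN y (v y))) x := by
  have h := ((contMDiff_equivTangentBundleProd_symm (I := 𝓘(ℝ)) (M := ℝ) (I' := I) (M' := N)
    (n := ∞)).mdifferentiableAt (by simp)).comp x
      (((contMDiff_zeroTangent.mdifferentiableAt (by simp)).comp x mdifferentiableAt_fst).prodMk hv)
  refine h.congr_of_eventuallyEq (.of_forall fun y ↦ ?_)
  simp only [inclN_apply]
  rfl

variable (I) in
theorem isSmoothVectorField_xiExt : IsSmoothVectorField (xiExt (I := I) (N := N)) := by
  have h1 : ContMDiff 𝓘(ℝ) 𝓘(ℝ).tangent ∞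
      (fun t : ℝ ↦ TotalSpace.mk' ℝ (E := fun t : ℝ ↦ TangentSpace 𝓘(ℝ) t) t (1 : ℝ)) := by
    exact contMDiff_vectorSpace_iff_contDiff.2 contDiff_const
  have h2 : ContMDiff I I.tangent ∞
      (fun p : N ↦ TotalSpace.mk' E (E := fun p : N ↦ TangentSpace I p) p 0) :=
    Bundle.contMDiff_zeroSection ℝ (fun p : N ↦ TangentSpace I p)
  have h := (contMDiff_equivTangentBundleProd_symm (I := 𝓘(ℝ)) (M := ℝ) (I' := I) (M' := N)
    (n := ∞)).comp
      ((h1.comp contMDiff_fst).prodMk (h2.comp contMDiff_snd))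
  refine h.congr fun y ↦ ?_
  simp only [xiExt_eq]
  rfl

variable [FiniteDimensional ℝ E]

variable (I) in
theorem isSmoothOneForm_etaExt : IsSmoothOneForm (etaExt (I := I) (N := N)) := by
  intro x
  refine contMDiffAt_hom_of_apply (IB := 𝓘(ℝ).prod I) (F₁ := ℝ × E) (F₂ := ℝ)
    (E₁ := fun x : ℝ × N ↦ TangentSpace (𝓘(ℝ).prod I) x) (E₂ := Trivial (ℝ × N) ℝ) fun σ hσ ↦ ?_
  rw [contMDiffAt_totalSpace]
  refine ⟨contMDiffAt_id, ?_⟩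
  -- `dt` is the fibre part of the tangent map of `Prod.fst`, and the trivialization of `Tℝ` is the
  -- identity on fibres.
  have h : ContMDiff (𝓘(ℝ).prod I).tangent 𝓘(ℝ).tangent ∞
      (tangentMap (𝓘(ℝ).prod I) 𝓘(ℝ) (Prod.fst : ℝ × N → ℝ)) :=
    contMDiff_fst.contMDiff_tangentMap (n := ∞) (by simp)
  have h2 := (contMDiffAt_totalSpace.1 (h.contMDiffAt.comp x hσ)).2
  refine h2.congr_of_eventuallyEq (.of_forall fun y ↦ ?_)
  simp only [Function.comp_apply, tangentMap_prodFst, Trivial.trivialization_apply,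
    Trivial.eq_trivialization, TangentBundle.trivializationAt_apply, etaExt_apply]
  simp [chartAt_self_eq]

theorem isSmoothEndomorphism_phiExt {P : Π p : N, TangentSpace I p →L[ℝ] TangentSpace I p}
    (hP : IsSmoothEndomorphism P) : IsSmoothEndomorphism (phiExt P) := by
  intro x
  refine contMDiffAt_hom_of_apply (IB := 𝓘(ℝ).prod I) (F₁ := ℝ × E) (F₂ := ℝ × E)
    (E₁ := fun x : ℝ × N ↦ TangentSpace (𝓘(ℝ).prod I) x)
    (E₂ := fun x : ℝ × N ↦ TangentSpace (𝓘(ℝ).prod I) x) fun σ hσ ↦ ?_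
  exact contMDiffAt_inclN (((hP x.2).comp x contMDiffAt_snd).clm_bundle_apply
    (E₁ := fun p : N ↦ TangentSpace I p) (E₂ := fun p : N ↦ TangentSpace I p)
    (contMDiffAt_projN hσ))


/-- The bilinear form `dt² + cosh(2t) h + sinh(2t) h̃` as a continuous bilinear map. -/
def metricForm (P : Π p : N, TangentSpace I p →L[ℝ] TangentSpace I p) (h : RMetric I N)
    (x : ℝ × N) : TangentSpace (𝓘(ℝ).prod I) x →L[ℝ] TangentSpace (𝓘(ℝ).prod I) x →L[ℝ] ℝ :=
  (etaExt x).smulRight (etaExt x)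
    + Real.cosh (2 * x.1) • (ContinuousLinearMap.precomp ℝ (projN x) ∘L h.inner x.2 ∘L projN x)
    + Real.sinh (2 * x.1) •
      (ContinuousLinearMap.precomp ℝ (P x.2 ∘L projN x) ∘L h.inner x.2 ∘L projN x)

omit [FiniteDimensional ℝ E] in
theorem metricForm_apply (P : Π p : N, TangentSpace I p →L[ℝ] TangentSpace I p) (h : RMetric I N)
    (x : ℝ × N) (u v : TangentSpace (𝓘(ℝ).prod I) x) :
    metricForm P h x u v = metricExt P h x u v := by
  simp [metricForm, metricExt]

/-- Two uses of `contMDiffAt_hom_of_apply` reduce the claim to the scalar function `g(σ, τ)` for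
local smooth `σ`, `τ`. -/
theorem contMDiff_metricForm {P : Π p : N, TangentSpace I p →L[ℝ] TangentSpace I p}
    (hP : IsSmoothEndomorphism P) (h : RMetric I N) :
    ContMDiff (𝓘(ℝ).prod I) ((𝓘(ℝ).prod I).prod 𝓘(ℝ, (ℝ × E) →L[ℝ] (ℝ × E) →L[ℝ] ℝ)) ∞
      (fun x ↦ TotalSpace.mk' ((ℝ × E) →L[ℝ] (ℝ × E) →L[ℝ] ℝ)
        (E := fun x : ℝ × N ↦ TangentSpace (𝓘(ℝ).prod I) x →L[ℝ]
          TangentSpace (𝓘(ℝ).prod I) x →L[ℝ] ℝ) x (metricForm P h x)) := by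
  intro x
  refine contMDiffAt_hom_of_apply (IB := 𝓘(ℝ).prod I) (F₁ := ℝ × E) (F₂ := (ℝ × E) →L[ℝ] ℝ)
    (E₁ := fun x : ℝ × N ↦ TangentSpace (𝓘(ℝ).prod I) x)
    (E₂ := fun x : ℝ × N ↦ TangentSpace (𝓘(ℝ).prod I) x →L[ℝ] ℝ) fun σ hσ ↦ ?_
  refine contMDiffAt_hom_of_apply (IB := 𝓘(ℝ).prod I) (F₁ := ℝ × E) (F₂ := ℝ)
    (E₁ := fun x : ℝ × N ↦ TangentSpace (𝓘(ℝ).prod I) x) (E₂ := Trivial (ℝ × N) ℝ) fun τ hτ ↦ ?_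
  rw [contMDiffAt_totalSpace]
  refine ⟨contMDiffAt_id, ?_⟩
  have hη : ∀ ρ : Π x : ℝ × N, TangentSpace (𝓘(ℝ).prod I) x,
      ContMDiffAt (𝓘(ℝ).prod I) ((𝓘(ℝ).prod I).prod 𝓘(ℝ, ℝ × E)) ∞
      (fun y ↦ TotalSpace.mk' (ℝ × E) (E := fun y : ℝ × N ↦ TangentSpace (𝓘(ℝ).prod I) y)
        y (ρ y)) x → ContMDiffAt (𝓘(ℝ).prod I) 𝓘(ℝ) ∞ (fun y ↦ etaExt y (ρ y)) x := by
    intro ρ hρ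
    have := (isSmoothOneForm_etaExt I x).clm_bundle_apply
      (E₁ := fun x : ℝ × N ↦ TangentSpace (𝓘(ℝ).prod I) x) (E₂ := Trivial (ℝ × N) ℝ) hρ
    exact (contMDiffAt_totalSpace.1 this).2
  have hh : ∀ a b : Π x : ℝ × N, TangentSpace I x.2,
      ContMDiffAt (𝓘(ℝ).prod I) (I.prod 𝓘(ℝ, E)) ∞
        (fun y ↦ TotalSpace.mk' E (E := fun p : N ↦ TangentSpace I p) y.2 (a y)) x →
      ContMDiffAt (𝓘(ℝ).prod I) (I.prod 𝓘(ℝ, E)) ∞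
        (fun y ↦ TotalSpace.mk' E (E := fun p : N ↦ TangentSpace I p) y.2 (b y)) x →
      ContMDiffAt (𝓘(ℝ).prod I) 𝓘(ℝ) ∞ (fun y ↦ h.inner y.2 (a y) (b y)) x := by
    intro a b ha hb
    have := ContMDiffAt.clm_bundle_apply₂ (F₁ := E) (F₂ := E) (F₃ := ℝ) (b := Prod.snd)
      (E₁ := fun p : N ↦ TangentSpace I p) (E₂ := fun p : N ↦ TangentSpace I p)
      (E₃ := Trivial N ℝ) ((h.contMDiff x.2).comp x contMDiffAt_snd) ha hb
    exact (contMDiffAt_totalSpace.1 this).2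
  have hc : ContMDiffAt (𝓘(ℝ).prod I) 𝓘(ℝ) ∞ (fun y : ℝ × N ↦ Real.cosh (2 * y.1)) x :=
    (Real.contDiff_cosh.comp (contDiff_const.mul contDiff_id)).contMDiff.contMDiffAt.comp x
      contMDiffAt_fst
  have hs : ContMDiffAt (𝓘(ℝ).prod I) 𝓘(ℝ) ∞ (fun y : ℝ × N ↦ Real.sinh (2 * y.1)) x :=
    (Real.contDiff_sinh.comp (contDiff_const.mul contDiff_id)).contMDiff.contMDiffAt.comp x
      contMDiffAt_fst
  have hPτ := ((hP x.2).comp x contMDiffAt_snd).clm_bundle_apply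
    (E₁ := fun p : N ↦ TangentSpace I p) (E₂ := fun p : N ↦ TangentSpace I p)
    (contMDiffAt_projN hτ)
  have key := (((hη σ hσ).mul (hη τ hτ)).add
    (hc.mul (hh _ _ (contMDiffAt_projN hσ) (contMDiffAt_projN hτ)))).add
    (hs.mul (hh _ _ (contMDiffAt_projN hσ) hPτ))
  refine key.congr_of_eventuallyEq (.of_forall fun y ↦ ?_)
  exact metricForm_apply P h y (σ y) (τ y)

end Product

/-! ### Comparison of `g` with `h`, and the almost paracontact structure -/

section Base

variable {E : Type*} [NormedAddCommGroup E] [NormedSpace ℝ E]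
  {H : Type*} [TopologicalSpace H] {I : ModelWithCorners ℝ E H}
  {N : Type*} [TopologicalSpace N] [ChartedSpace H N] [IsManifold I ∞ N]
  {P : Π p : N, TangentSpace I p →L[ℝ] TangentSpace I p} {h : RMetric I N}

theorem inner_self_nonneg (h : RMetric I N) (p : N) (v : TangentSpace I p) :
    0 ≤ h.inner p v v := by
  by_cases hv : v = 0
  · simp [hv]
  · exact (h.pos p v hv).le

theorem inner_smul_smul_self (h : RMetric I N) (p : N) (c : ℝ) (v : TangentSpace I p) :
    h.inner p (c • v) (c • v) = c ^ 2 * h.inner p v v := by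
  simp only [map_smul, smul_apply, smul_eq_mul]
  ring

variable [FiniteDimensional ℝ E] {n : ℕ}

theorem IsParaholomorphic.inner_symm (hP : IsParaholomorphic n P h) (p : N)
    (u v : TangentSpace I p) : h.inner p (P p u) v = h.inner p u (P p v) := by
  rw [← hP.isometry p (P p u) v, hP.sq]

/-- Both `h(u ± Pu, u ± Pu) = 2 (h(u, u) ± h(u, Pu))` are nonnegative. -/
theorem IsParaholomorphic.abs_inner_le (hP : IsParaholomorphic n P h) (p : N)
    (u : TangentSpace I p) : |h.inner p u (P p u)| ≤ h.inner p u u := by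
  have h1 := inner_self_nonneg h p (u + P p u)
  have h2 := inner_self_nonneg h p (u - P p u)
  simp only [map_add, map_sub, add_apply, sub_apply, hP.isometry, hP.inner_symm] at h1 h2
  rw [abs_le]
  constructor <;> linarith

/-- For `a = h(u, u)` and `b = h(u, Pu)`, the numbers `(a ± b) / 2` are the squared lengths of the
`±1` components of `u`, and the form scales them by `e^{±s}`. -/
theorem cosh_add_sinh_mul_bounds (s a b : ℝ) (hab : |b| ≤ a) :
    Real.exp (-|s|) * a ≤ Real.cosh s * a + Real.sinh s * b ∧
      Real.cosh s * a + Real.sinh s * b ≤ Real.exp |s| * a := by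
  have ha : 0 ≤ a := (abs_nonneg _).trans hab
  obtain ⟨h1, h2⟩ := abs_le.1 hab
  have e : Real.cosh s * a + Real.sinh s * b
      = Real.exp s * ((a + b) / 2) + Real.exp (-s) * ((a - b) / 2) := by
    rw [Real.cosh_eq, Real.sinh_eq]; ring
  have l1 : Real.exp (-|s|) ≤ Real.exp s := Real.exp_le_exp.2 (neg_abs_le s)
  have l2 : Real.exp (-|s|) ≤ Real.exp (-s) := Real.exp_le_exp.2 (neg_le_neg (le_abs_self s))
  have u1 : Real.exp s ≤ Real.exp |s| := Real.exp_le_exp.2 (le_abs_self s)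
  have u2 : Real.exp (-s) ≤ Real.exp |s| := Real.exp_le_exp.2 (neg_le_abs s)
  have p1 : 0 ≤ (a + b) / 2 := by linarith
  have p2 : 0 ≤ (a - b) / 2 := by linarith
  rw [e]
  constructor
  · linarith [mul_le_mul_of_nonneg_right l1 p1, mul_le_mul_of_nonneg_right l2 p2]
  · linarith [mul_le_mul_of_nonneg_right u1 p1, mul_le_mul_of_nonneg_right u2 p2]

theorem IsParaholomorphic.le_metricExt (hP : IsParaholomorphic n P h) (x : ℝ × N)
    (u : TangentSpace (𝓘(ℝ).prod I) x) :
    etaExt x u ^ 2 + Real.exp (-|2 * x.1|) * h.inner x.2 (projN x u) (projN x u)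
      ≤ metricExt P h x u u := by
  have := (cosh_add_sinh_mul_bounds (2 * x.1) _ _ (hP.abs_inner_le x.2 (projN x u))).1
  simp only [metricExt]
  linarith

theorem IsParaholomorphic.metricExt_le (hP : IsParaholomorphic n P h) (x : ℝ × N)
    (u : TangentSpace (𝓘(ℝ).prod I) x) :
    metricExt P h x u u
      ≤ etaExt x u ^ 2 + Real.exp |2 * x.1| * h.inner x.2 (projN x u) (projN x u) := by
  have := (cosh_add_sinh_mul_bounds (2 * x.1) _ _ (hP.abs_inner_le x.2 (projN x u))).2
  simp only [metricExt]
  linarith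

theorem IsParaholomorphic.metricExt_symm (hP : IsParaholomorphic n P h) (x : ℝ × N)
    (u v : TangentSpace (𝓘(ℝ).prod I) x) : metricExt P h x u v = metricExt P h x v u := by
  simp only [metricExt, h.symm x.2 (projN x u), hP.inner_symm, mul_comm (etaExt x u)]

theorem IsParaholomorphic.metricExt_pos (hP : IsParaholomorphic n P h) (x : ℝ × N)
    (u : TangentSpace (𝓘(ℝ).prod I) x) (hu : u ≠ 0) : 0 < metricExt P h x u u := by
  refine lt_of_lt_of_le ?_ (hP.le_metricExt x u)
  by_cases hv : projN x u = 0
  · have : etaExt x u ≠ 0 := fun h0 ↦ hu <| by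
      rw [eq_smul_xiExt_add_inclN x u, h0, hv, zero_smul, map_zero, add_zero]
    rw [hv]
    simp only [map_zero, mul_zero, add_zero]
    positivity
  · have := h.pos x.2 _ hv
    positivity

omit [FiniteDimensional ℝ E] in
-- If `q u < 1` then `|dt(u)| ≤ 1` and `c` times the `N` part of `u` lies in the unit ball of `h`,
-- which is bounded. The constant enters as a square so that it can be absorbed into the vector.
theorem isVonNBounded_of_le (h : RMetric I N) (x : ℝ × N) (c : ℝ) (hc : 0 < c)
    (q : TangentSpace (𝓘(ℝ).prod I) x → ℝ)
    (hq : ∀ u, etaExt x u ^ 2 + c ^ 2 * h.inner x.2 (projN x u) (projN x u) ≤ q u) :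
    Bornology.IsVonNBounded ℝ {u : TangentSpace (𝓘(ℝ).prod I) x | q u < 1} := by
  have hb : Bornology.IsVonNBounded ℝ ({v : E | h.inner x.2 (v : TangentSpace I x.2) v < 1}) :=
    h.isVonNBounded x.2
  obtain ⟨R, hR⟩ := (NormedSpace.isVonNBounded_iff' ℝ).1 hb
  have hq' : ∀ u : TangentSpace (𝓘(ℝ).prod I) x, (u.1 : ℝ) ^ 2
      + c ^ 2 * h.inner x.2 (u.2 : TangentSpace I x.2) (u.2 : TangentSpace I x.2) ≤ q u := by
    intro u
    have := hq u
    rwa [etaExt_apply, projN_apply] at this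
  change Bornology.IsVonNBounded ℝ {u : ℝ × E | q u < 1}
  rw [NormedSpace.isVonNBounded_iff' ℝ]
  refine ⟨max 1 (c⁻¹ * R), fun u hu ↦ ?_⟩
  have hu1 := (hq' u).trans_lt hu
  have n0 := inner_self_nonneg h x.2 (u.2 : TangentSpace I x.2)
  rw [Prod.norm_def]
  refine max_le_max ?_ ?_
  · rw [Real.norm_eq_abs, ← sq_le_one_iff_abs_le_one]
    have : 0 ≤ c ^ 2 * h.inner x.2 (u.2 : TangentSpace I x.2) (u.2 : TangentSpace I x.2) := by
      positivity
    have h3 : (u.1 : ℝ) ^ 2 + c ^ 2 * h.inner x.2 (u.2 : TangentSpace I x.2)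
      (u.2 : TangentSpace I x.2) < 1 := hu1
    linarith
  · have h2 : h.inner x.2 (c • u.2 : TangentSpace I x.2) (c • u.2 : TangentSpace I x.2) < 1 := by
      have e : h.inner x.2 (c • u.2 : TangentSpace I x.2) (c • u.2 : TangentSpace I x.2)
          = c ^ 2 * h.inner x.2 (u.2 : TangentSpace I x.2) (u.2 : TangentSpace I x.2) :=
        inner_smul_smul_self h x.2 c u.2
      rw [e]
      have h3 : (u.1 : ℝ) ^ 2 + c ^ 2 * h.inner x.2 (u.2 : TangentSpace I x.2)
        (u.2 : TangentSpace I x.2) < 1 := hu1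
      nlinarith [sq_nonneg (u.1 : ℝ)]
    have h4 : ‖(c • u.2 : E)‖ ≤ R := hR (c • u.2 : E) h2
    rw [norm_smul, Real.norm_eq_abs, abs_of_pos hc] at h4
    rw [inv_mul_eq_div, le_div_iff₀ hc]
    linarith

/-- The Riemannian metric `dt² + cosh(2t) h + sinh(2t) h̃` on `ℝ × N`. -/
def hypMetric (hP : IsParaholomorphic n P h) : RMetric (𝓘(ℝ).prod I) (ℝ × N) where
  inner := metricForm P h
  symm x u v := by simp only [metricForm_apply, hP.metricExt_symm x u v]
  pos x u hu := by simpa only [metricForm_apply] using hP.metricExt_pos x u hu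
  isVonNBounded x := by
    refine isVonNBounded_of_le h x (Real.exp (-|x.1|)) (Real.exp_pos _) _ fun u ↦ ?_
    have e : Real.exp (-|x.1|) ^ 2 = Real.exp (-|2 * x.1|) := by
      rw [← Real.exp_nat_mul]
      congr 1
      rw [abs_mul]
      simp
    rw [e, metricForm_apply]
    exact hP.le_metricExt x u
  contMDiff := contMDiff_metricForm hP.smooth h

@[simp] theorem hypMetric_inner (hP : IsParaholomorphic n P h) (x : ℝ × N)
    (u v : TangentSpace (𝓘(ℝ).prod I) x) :
    (hypMetric hP).inner x u v = metricExt P h x u v :=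
  metricForm_apply P h x u v

omit [IsManifold I ∞ N] [FiniteDimensional ℝ E] in
-- The injection `inclN` intertwines `P` with `φ` and has image `ker η`.
theorem finrank_eigenspace_phiExt (P : Π p : N, TangentSpace I p →L[ℝ] TangentSpace I p)
    (x : ℝ × N) (μ : ℝ) :
    Module.finrank ℝ (Module.End.eigenspace (phiExt P x).toLinearMap μ ⊓
      (etaExt x).toLinearMap.ker : Submodule ℝ (TangentSpace (𝓘(ℝ).prod I) x))
      = Module.finrank ℝ (Module.End.eigenspace (P x.2).toLinearMap μ) := by
  have inj : Function.Injective (inclN (I := I) x).toLinearMap :=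
    Function.LeftInverse.injective (g := projN x) fun v ↦ projN_inclN x v
  have e : (Module.End.eigenspace (phiExt P x).toLinearMap μ ⊓ (etaExt x).toLinearMap.ker :
      Submodule ℝ (TangentSpace (𝓘(ℝ).prod I) x))
      = (Module.End.eigenspace (P x.2).toLinearMap μ).map (inclN (I := I) x).toLinearMap := by
    ext u
    simp only [Submodule.mem_inf, Module.End.mem_eigenspace_iff, LinearMap.mem_ker,
      Submodule.mem_map, ContinuousLinearMap.coe_coe]
    constructor
    · rintro ⟨hu, h0⟩
      have hu' := eq_inclN_of_etaExt_eq_zero h0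
      refine ⟨projN x u, ?_, hu'.symm⟩
      have := congrArg (projN x) hu
      rwa [hu', phiExt_inclN, map_smul, projN_inclN, projN_inclN] at this
    · rintro ⟨v, hv, rfl⟩
      simp [hv]
  rw [e]
  exact (LinearEquiv.finrank_eq (Submodule.equivMapOfInjective _ inj _)).symm

theorem isAlmostParacontactParacomplex_hypMetric (hP : IsParaholomorphic n P h) :
    IsAlmostParacontactParacomplex n (phiExt P) xiExt etaExt (hypMetric hP) where
  smooth_phi := isSmoothEndomorphism_phiExt hP.smooth
  smooth_xi := isSmoothVectorField_xiExt I
  smooth_eta := isSmoothOneForm_etaExt I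
  sq x u := by
    rw [eq_sub_iff_add_eq']
    conv_rhs => rw [eq_smul_xiExt_add_inclN x u]
    simp [phiExt, hP.sq]
  eta_xi x := etaExt_xiExt x
  finrank_pos x := by rw [finrank_eigenspace_phiExt, hP.finrank_pos]
  finrank_neg x := by rw [finrank_eigenspace_phiExt, hP.finrank_neg]
  inner_xi x u := by simp [metricExt]
  inner_phi x u v := by 
    simp [metricExt, phiExt, hP.isometry]
    ring

end Base

/-! ### Lifted vector fields and their Lie brackets -/

section Lift

variable {E : Type*} [NormedAddCommGroup E] [NormedSpace ℝ E]
  {H : Type*} [TopologicalSpace H] {I : ModelWithCorners ℝ E H}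
  {N : Type*} [TopologicalSpace N] [ChartedSpace H N]

/-- The vector field `a ∂/∂t + X` on `ℝ × N`, for a vector field `X` on `N` and a constant `a`. -/
def liftField (a : ℝ) (X : Π p : N, TangentSpace I p) (x : ℝ × N) :
    TangentSpace (𝓘(ℝ).prod I) x :=
  a • xiExt x + inclN x (X x.2)

@[simp] theorem etaExt_liftField (a : ℝ) (X : Π p : N, TangentSpace I p) (x : ℝ × N) :
    etaExt x (liftField a X x) = a := by
  simp [liftField]

@[simp] theorem projN_liftField (a : ℝ) (X : Π p : N, TangentSpace I p) (x : ℝ × N) :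
    projN x (liftField a X x) = X x.2 := by
  simp [liftField]

theorem phiExt_liftField (P : Π p : N, TangentSpace I p →L[ℝ] TangentSpace I p) (a : ℝ)
    (X : Π p : N, TangentSpace I p) (x : ℝ × N) :
    phiExt P x (liftField a X x) = liftField 0 (fun p ↦ P p (X p)) x := by
  simp [liftField, phiExt]

theorem liftField_eq (a : ℝ) (X : Π p : N, TangentSpace I p) (x : ℝ × N) :
    liftField a X x = ((a, X x.2) : ℝ × E) := by
  rw [liftField, inclN_apply, xiExt_eq]
  refine Prod.ext (α := ℝ) (β := E) ?_ ?_
  · change a * 1 + 0 = a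
    simp
  · change a • (0 : TangentSpace I x.2) + X x.2 = X x.2
    simp

theorem extChartAt_prod_symm_apply (x : ℝ × N) :
    ((extChartAt (𝓘(ℝ).prod I) x).symm : ℝ × E → ℝ × N)
      = Prod.map id (extChartAt I x.2).symm := by
  rw [extChartAt_prod]
  simp
  rfl

theorem extChartAt_prod_apply (x : ℝ × N) :
    (extChartAt (𝓘(ℝ).prod I) x : ℝ × N → ℝ × E) = Prod.map id (extChartAt I x.2) := by
  rw [extChartAt_prod]
  simp
  rfl

section

variable [IsManifold I ∞ N]

theorem mdifferentiableAt_liftField (a : ℝ) {X : Π p : N, TangentSpace I p} {x : ℝ × N}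
    (hX : MDiffAt (T% X) x.2) : MDiffAt (T% (liftField a X)) x := by
  have h1 : MDiffAt (T% (xiExt (I := I) (N := N))) x :=
    (isSmoothVectorField_xiExt I).mdifferentiableAt (by simp)
  have h2 : MDiffAt (T% (fun y : ℝ × N ↦ inclN y (X y.2))) x :=
    mdifferentiableAt_inclN (hX.comp x mdifferentiableAt_snd)
  have h3 : MDiffAt (fun _ : ℝ × N ↦ a) x := mdifferentiableAt_const
  exact mdifferentiableAt_add_section (h3.smul_section h1) h2

variable [I.Boundaryless]

/-- The product chart is `id` times the chart of `N`, so its derivative is block diagonal. A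
pullback involves the inverse derivative; the claim is checked by applying the derivative itself to
the claimed value. -/
theorem mpullbackWithin_extChartAt_liftField (a : ℝ) (X : Π p : N, TangentSpace I p) (x : ℝ × N)
    {z : ℝ × E} (hz : z.2 ∈ (extChartAt I x.2).target) :
    VectorField.mpullbackWithin 𝓘(ℝ, ℝ × E) (𝓘(ℝ).prod I) (extChartAt (𝓘(ℝ).prod I) x).symm
      (liftField a X) (Set.range (𝓘(ℝ).prod I)) z
      = (a, VectorField.mpullbackWithin 𝓘(ℝ, E) I (extChartAt I x.2).symm X (Set.range I) z.2) := by
  have hz' : z ∈ (extChartAt (𝓘(ℝ).prod I) x).target := by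
    rw [extChartAt_prod]
    exact ⟨by simp [chartAt_self_eq], hz⟩
  have hI := isInvertible_mfderivWithin_extChartAt_symm hz'
  have hI' := isInvertible_mfderivWithin_extChartAt_symm hz
  have hd := mdifferentiableWithinAt_extChartAt_symm hz
  rw [VectorField.mpullbackWithin_apply]
  set w := VectorField.mpullbackWithin 𝓘(ℝ, E) I (extChartAt I x.2).symm X (Set.range I) z.2
    with hw
  have ew : mfderivWithin 𝓘(ℝ, E) I (extChartAt I x.2).symm (Set.range I) z.2 w
      = X ((extChartAt I x.2).symm z.2) := by
    rw [hw, VectorField.mpullbackWithin_apply]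
    exact hI'.self_apply_inverse _
  have key : mfderivWithin 𝓘(ℝ, ℝ × E) (𝓘(ℝ).prod I) (extChartAt (𝓘(ℝ).prod I) x).symm
      (Set.range (𝓘(ℝ).prod I)) z (a, w)
      = liftField a X ((extChartAt (𝓘(ℝ).prod I) x).symm z) := by
    simp only [ModelWithCorners.range_eq_univ, mfderivWithin_univ,
      mdifferentiableWithinAt_univ] at ew hd ⊢
    rw [liftField_eq, extChartAt_prod_symm_apply, modelWithCornersSelf_prod, ← chartedSpaceSelf_prod,
      mfderiv_prodMap mdifferentiableAt_id hd, mfderiv_id]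
    exact Prod.ext rfl ew
  rw [← key]
  exact hI.inverse_apply_self _

end

/-- The first components are constant and the second ignore the `ℝ` variable, so derivatives are
blockwise. Equality near `z` is all that is assumed, because the chart formula for a lift holds only
over the chart target. -/
theorem lieBracketWithin_prod (a b : ℝ) {X Y : E → E} {V W : ℝ × E → ℝ × E} {z : ℝ × E}
    (hX : DifferentiableWithinAt ℝ X Set.univ z.2) (hY : DifferentiableWithinAt ℝ Y Set.univ z.2)
    (hV : V =ᶠ[𝓝 z] fun y ↦ (a, X y.2)) (hW : W =ᶠ[𝓝 z] fun y ↦ (b, Y y.2)) :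
    VectorField.lieBracketWithin ℝ V W Set.univ z
      = (0, VectorField.lieBracketWithin ℝ X Y Set.univ z.2) := by
  rw [differentiableWithinAt_univ] at hX hY
  rw [VectorField.lieBracketWithin_univ, VectorField.lieBracketWithin_univ,
    hV.lieBracket_vectorField_eq hW]
  have dfd (c : ℝ) (Z : E → E) (hZ : DifferentiableAt ℝ Z z.2) (v : ℝ × E) :
      fderiv ℝ (fun y : ℝ × E ↦ (c, Z y.2)) z v = (0, fderiv ℝ Z z.2 v.2) := by
    have h1 := hZ.hasFDerivAt.comp z hasFDerivAt_snd
    have h2 : HasFDerivAt (fun y : ℝ × E ↦ (c, Z y.2)) _ z := (hasFDerivAt_const c z).prodMk h1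
    rw [h2.fderiv]
    rfl
  rw [VectorField.lieBracket, dfd _ _ hX, dfd _ _ hY, VectorField.lieBracket]
  simp

variable [IsManifold I ∞ N] [I.Boundaryless]

theorem mlieBracket_liftField [CompleteSpace E] (a b : ℝ) {X Y : Π p : N, TangentSpace I p}
    {x : ℝ × N} (hX : MDiffAt (T% X) x.2) (hY : MDiffAt (T% Y) x.2) :
    VectorField.mlieBracket (𝓘(ℝ).prod I) (liftField a X) (liftField b Y) x
      = inclN x (VectorField.mlieBracket I X Y x.2) := by
  have : IsManifold I 2 N := .of_le (n := ∞) (WithTop.coe_le_coe.2 le_top)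
  have dX := (mdifferentiableWithinAt_univ.2 hX).differentiableWithinAt_mpullbackWithin_vectorField
  have dY := (mdifferentiableWithinAt_univ.2 hY).differentiableWithinAt_mpullbackWithin_vectorField
  rw [← VectorField.mlieBracketWithin_univ, ← VectorField.mlieBracketWithin_univ,
    VectorField.mlieBracketWithin_apply]
  have hI := isInvertible_mfderiv_extChartAt (I := 𝓘(ℝ).prod I) (mem_extChartAt_source x)
  have hI' := isInvertible_mfderiv_extChartAt (I := I) (mem_extChartAt_source x.2)
  have hd := mdifferentiableAt_extChartAt (I := I) (mem_chart_source H x.2)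
  have eN := VectorField.mlieBracketWithin_apply (I := I) (V := X) (W := Y) (s := Set.univ)
    (x₀ := x.2)
  have eV (c : ℝ) (Z : Π p : N, TangentSpace I p) :=
    fun z hz ↦ mpullbackWithin_extChartAt_liftField c Z x (z := z) hz
  simp only [Set.preimage_univ, Set.univ_inter, ModelWithCorners.range_eq_univ] at dX dY eN eV ⊢
  have ez : extChartAt (𝓘(ℝ).prod I) x x = (x.1, extChartAt I x.2 x.2) := by
    rw [extChartAt_prod_apply]
    rfl
  have hev : ∀ᶠ z : ℝ × E in 𝓝 (x.1, extChartAt I x.2 x.2), z.2 ∈ (extChartAt I x.2).target :=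
    continuousAt_snd.eventually (extChartAt_target_mem_nhds x.2)
  have eb := lieBracketWithin_prod (z := (x.1, extChartAt I x.2 x.2)) a b dX dY
    (hev.mono fun z hz ↦ eV a X z hz) (hev.mono fun z hz ↦ eV b Y z hz)
  rw [← ez] at eb
  -- The chart derivative sends the claimed bracket to the one computed in coordinates; it is
  -- invertible, so the two brackets agree.
  have key : mfderiv (𝓘(ℝ).prod I) 𝓘(ℝ, ℝ × E) (extChartAt (𝓘(ℝ).prod I) x) x
      (inclN x (VectorField.mlieBracketWithin I X Y Set.univ x.2))
      = ((0, VectorField.lieBracketWithin ℝ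
        (VectorField.mpullbackWithin 𝓘(ℝ, E) I (extChartAt I x.2).symm X Set.univ)
        (VectorField.mpullbackWithin 𝓘(ℝ, E) I (extChartAt I x.2).symm Y Set.univ) Set.univ
        (extChartAt I x.2 x.2)) : ℝ × E) := by
    rw [inclN_apply, extChartAt_prod_apply, modelWithCornersSelf_prod, ← chartedSpaceSelf_prod,
      mfderiv_prodMap mdifferentiableAt_id hd, mfderiv_id, eN]
    exact Prod.ext rfl (hI'.self_apply_inverse _)
  exact (congrArg _ (eb.trans key.symm)).trans (hI.inverse_apply_self _)

end Lift

/-! ### The Levi-Civita connection of `g` and the covariant derivative of `φ` -/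

section Connection

variable {E : Type*} [NormedAddCommGroup E] [NormedSpace ℝ E]
  {H : Type*} [TopologicalSpace H] {I : ModelWithCorners ℝ E H}
  {N : Type*} [TopologicalSpace N] [ChartedSpace H N]

/-- By `metricExt_liftField`, the product of two lifts has exactly this shape, so one formula serves
all three derivative terms of the Koszul formula. -/
theorem mvfderiv_cosh_add_sinh {A B : N → ℝ} {x : ℝ × N} (hA : MDiffAt A x.2)
    (hB : MDiffAt B x.2) (k : ℝ) (u : TangentSpace (𝓘(ℝ).prod I) x) :
    mvfderiv (𝓘(ℝ).prod I)
      (fun y : ℝ × N ↦ k + Real.cosh (2 * y.1) * A y.2 + Real.sinh (2 * y.1) * B y.2) x u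
      = etaExt x u * (2 * Real.sinh (2 * x.1) * A x.2 + 2 * Real.cosh (2 * x.1) * B x.2)
        + Real.cosh (2 * x.1) * mvfderiv I A x.2 (projN x u)
        + Real.sinh (2 * x.1) * mvfderiv I B x.2 (projN x u) := by
  have hsnd : MDifferentiableAt (𝓘(ℝ).prod I) I (Prod.snd : ℝ × N → N) x := mdifferentiableAt_snd
  have hfst : MDifferentiableAt (𝓘(ℝ).prod I) 𝓘(ℝ) (Prod.fst : ℝ × N → ℝ) x :=
    mdifferentiableAt_fst
  have lin (s : ℝ) : HasDerivAt (fun t : ℝ ↦ 2 * t) 2 s := by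
    simpa using (hasDerivAt_id s).const_mul 2
  have dc : HasDerivAt (fun t : ℝ ↦ Real.cosh (2 * t)) (Real.sinh (2 * x.1) * 2) x.1 :=
    (Real.hasDerivAt_cosh _).comp x.1 (lin x.1)
  have ds : HasDerivAt (fun t : ℝ ↦ Real.sinh (2 * t)) (Real.cosh (2 * x.1) * 2) x.1 :=
    (Real.hasDerivAt_sinh _).comp x.1 (lin x.1)
  have comp_fst {f : ℝ → ℝ} {f' : ℝ} (hf : HasDerivAt f f' x.1) :
      MDifferentiableAt (𝓘(ℝ).prod I) 𝓘(ℝ) (f ∘ (Prod.fst : ℝ × N → ℝ)) x ∧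
      mvfderiv (𝓘(ℝ).prod I) (f ∘ (Prod.fst : ℝ × N → ℝ)) x u = f' * etaExt x u := by
    have hm : MDifferentiableAt 𝓘(ℝ) 𝓘(ℝ) f x.1 := hf.differentiableAt.mdifferentiableAt
    refine ⟨hm.comp x hfst, ?_⟩
    rw [mvfderiv_comp_apply x hm hfst]
    have e : mvfderiv 𝓘(ℝ) f x.1 = ContinuousLinearMap.toSpanSingleton ℝ f' := by
      rw [← hf.hasFDerivAt.fderiv, ← mfderiv_eq_fderiv]
      rfl
    rw [e, mul_comm]
    rfl
  obtain ⟨mc, ec⟩ := comp_fst dc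
  obtain ⟨ms, es⟩ := comp_fst ds
  have mA : MDifferentiableAt (𝓘(ℝ).prod I) 𝓘(ℝ) (A ∘ (Prod.snd : ℝ × N → N)) x :=
    hA.comp x hsnd
  have mB : MDifferentiableAt (𝓘(ℝ).prod I) 𝓘(ℝ) (B ∘ (Prod.snd : ℝ × N → N)) x :=
    hB.comp x hsnd
  have eA : mvfderiv (𝓘(ℝ).prod I) (A ∘ (Prod.snd : ℝ × N → N)) x u
      = mvfderiv I A x.2 (projN x u) := mvfderiv_comp_apply x hA hsnd u
  have eB : mvfderiv (𝓘(ℝ).prod I) (B ∘ (Prod.snd : ℝ × N → N)) x u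
      = mvfderiv I B x.2 (projN x u) := mvfderiv_comp_apply x hB hsnd u
  have mk : MDifferentiableAt (𝓘(ℝ).prod I) 𝓘(ℝ) (fun _ : ℝ × N ↦ k) x := mdifferentiableAt_const
  have e : (fun y : ℝ × N ↦ k + Real.cosh (2 * y.1) * A y.2 + Real.sinh (2 * y.1) * B y.2)
      = (fun _ ↦ k) + ((fun t : ℝ ↦ Real.cosh (2 * t)) ∘ Prod.fst) * (A ∘ Prod.snd)
        + ((fun t : ℝ ↦ Real.sinh (2 * t)) ∘ Prod.fst) * (B ∘ Prod.snd) := rfl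
  rw [e, mvfderiv_add (mk.add (mc.mul mA)) (ms.mul mB), mvfderiv_add mk (mc.mul mA),
    mvfderiv_mul mc mA, mvfderiv_mul ms mB, mvfderiv_const]
  simp only [add_apply, smul_apply, zero_apply, eA, eB, ec, es, smul_eq_mul, Function.comp_apply]
  ring

variable [IsManifold I ∞ N]

theorem metricExt_liftField (P : Π p : N, TangentSpace I p →L[ℝ] TangentSpace I p)
    (h : RMetric I N) (b c : ℝ) (Y Z : Π p : N, TangentSpace I p) (x : ℝ × N) :
    metricExt P h x (liftField b Y x) (liftField c Z x)
      = b * c + Real.cosh (2 * x.1) * h.inner x.2 (Y x.2) (Z x.2)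
        + Real.sinh (2 * x.1) * h.inner x.2 (Y x.2) (P x.2 (Z x.2)) := by
  simp [metricExt]

theorem IsSmoothEndomorphism.mdifferentiableAt_apply
    {φ : Π p : N, TangentSpace I p →L[ℝ] TangentSpace I p} (hφ : IsSmoothEndomorphism φ)
    {Y : Π p : N, TangentSpace I p} {p : N} (hY : MDiffAt (T% Y) p) :
    MDiffAt (T% (fun q ↦ φ q (Y q))) p :=
  (hφ.mdifferentiableAt (by simp)).clm_bundle_apply
    (E₁ := fun p : N ↦ TangentSpace I p) (E₂ := fun p : N ↦ TangentSpace I p) hY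

variable [FiniteDimensional ℝ E] {n : ℕ}
  {P : Π p : N, TangentSpace I p →L[ℝ] TangentSpace I p} {h : RMetric I N}

theorem leviCivita_sub_swap (h : RMetric I N) {X Y : Π p : N, TangentSpace I p} {p : N}
    (hX : MDiffAt (T% X) p) (hY : MDiffAt (T% Y) p) :
    VectorField.mlieBracket I X Y p
      = leviCivita h Y p (X p) - leviCivita h X p (Y p) :=
  ((CovariantDerivative.torsion_eq_zero_iff _).1 (leviCivita_torsion h) hX hY).symm

theorem IsParaholomorphic.leviCivita_apply (hP : IsParaholomorphic n P h)
    {Y : Π p : N, TangentSpace I p} {p : N} (hY : MDiffAt (T% Y) p) (u : TangentSpace I p) :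
    leviCivita h (fun q ↦ P q (Y q)) p u = P p (leviCivita h Y p u) :=
  sub_eq_zero.1 (hP.parallel p u Y hY)

variable [I.Boundaryless]

/-- Metric compatibility and vanishing torsion of `∇^h` turn the derivatives along `N` and the
brackets into terms in `∇^h`, and `∇^h P = 0` takes `P` out of them. The `∂/∂t` derivatives exchange
`cosh` and `sinh`, which amounts to inserting `P`. -/
theorem koszul_liftField (hP : IsParaholomorphic n P h) (a b c : ℝ)
    {X Y Z : Π p : N, TangentSpace I p} {x : ℝ × N} (hX : MDiffAt (T% X) x.2)
    (hY : MDiffAt (T% Y) x.2) (hZ : MDiffAt (T% Z) x.2) :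
    koszul (hypMetric hP) (liftField a X) (liftField b Y) (liftField c Z) x
      = 2 * (Real.cosh (2 * x.1) * h.inner x.2
          (leviCivita h Y x.2 (X x.2) + a • P x.2 (Y x.2) + b • P x.2 (X x.2)) (Z x.2)
        + Real.sinh (2 * x.1) * h.inner x.2
          (leviCivita h Y x.2 (X x.2) + a • P x.2 (Y x.2) + b • P x.2 (X x.2)) (P x.2 (Z x.2))
        - c * (Real.sinh (2 * x.1) * h.inner x.2 (X x.2) (Y x.2)
          + Real.cosh (2 * x.1) * h.inner x.2 (X x.2) (P x.2 (Y x.2)))) := by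
  have hPX := hP.smooth.mdifferentiableAt_apply hX
  have hPY := hP.smooth.mdifferentiableAt_apply hY
  have hPZ := hP.smooth.mdifferentiableAt_apply hZ
  simp only [koszul, hypMetric_inner, metricExt_liftField, mlieBracket_liftField a b hX hY,
    mlieBracket_liftField c a hZ hX, mlieBracket_liftField c b hZ hY]
  rw [mvfderiv_cosh_add_sinh (mdifferentiableAt_metric h hY hZ)
      (mdifferentiableAt_metric h hY hPZ),
    mvfderiv_cosh_add_sinh (mdifferentiableAt_metric h hZ hX)
      (mdifferentiableAt_metric h hZ hPX),
    mvfderiv_cosh_add_sinh (mdifferentiableAt_metric h hX hY)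
      (mdifferentiableAt_metric h hX hPY)]
  simp only [etaExt_liftField, projN_liftField, metricExt, etaExt_inclN, projN_inclN,
    leviCivita_metric h hX hY hZ, leviCivita_metric h hX hY hPZ, leviCivita_metric h hY hZ hX,
    leviCivita_metric h hY hZ hPX, leviCivita_metric h hZ hX hY, leviCivita_metric h hZ hX hPY,
    leviCivita_sub_swap h hX hY, leviCivita_sub_swap h hZ hX, leviCivita_sub_swap h hZ hY,
    hP.leviCivita_apply hX, hP.leviCivita_apply hY, hP.leviCivita_apply hZ,
    map_add, map_sub, map_smul, add_apply, sub_apply, smul_apply, smul_eq_mul]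
  -- Normal form: `P` and `∇^h` go to the first slot. Only the terms from differentiating `g(Z, X)`
  -- along `b ∂/∂t` then still have `X` and `Z` in the wrong order.
  have sP (u v : TangentSpace I x.2) : h.inner x.2 u (P x.2 v) = h.inner x.2 (P x.2 u) v :=
    (hP.inner_symm x.2 u v).symm
  have s0 (V W : Π p : N, TangentSpace I p) (u : TangentSpace I x.2) :
      h.inner x.2 (V x.2) (leviCivita h W x.2 u) = h.inner x.2 (leviCivita h W x.2 u) (V x.2) :=
    h.symm _ _ _
  have s1 (V W : Π p : N, TangentSpace I p) (u : TangentSpace I x.2) :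
      h.inner x.2 (P x.2 (V x.2)) (leviCivita h W x.2 u)
        = h.inner x.2 (P x.2 (leviCivita h W x.2 u)) (V x.2) := by
    rw [hP.inner_symm, h.symm]
  simp only [sP, s0, s1, hP.sq]
  have t1 := h.symm x.2 (Z x.2) (X x.2)
  have t2 : h.inner x.2 (P x.2 (Z x.2)) (X x.2) = h.inner x.2 (P x.2 (X x.2)) (Z x.2) := by
    rw [hP.inner_symm, h.symm]
  linear_combination (2 * b * Real.sinh (2 * x.1)) * t1 + (2 * b * Real.cosh (2 * x.1)) * t2

omit [FiniteDimensional ℝ E] [I.Boundaryless] in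
-- Every tangent vector is the value of a lift, so a tensorial identity need only be tested on
-- lifts.
theorem liftField_extend (x : ℝ × N) (u : TangentSpace (𝓘(ℝ).prod I) x) :
    liftField (etaExt x u) (FiberBundle.extend E (projN x u)) x = u := by
  conv_rhs => rw [eq_smul_xiExt_add_inclN x u]
  rw [liftField, FiberBundle.extend_apply_self]

/-- The Levi-Civita connection of `dt² + cosh(2t) h + sinh(2t) h̃`. -/
theorem leviCivita_liftField (hP : IsParaholomorphic n P h) (b : ℝ)
    {Y : Π p : N, TangentSpace I p} {x : ℝ × N} (hY : MDiffAt (T% Y) x.2)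
    (u : TangentSpace (𝓘(ℝ).prod I) x) :
    leviCivita (hypMetric hP) (liftField b Y) x u
      = inclN x (leviCivita h Y x.2 (projN x u) + etaExt x u • P x.2 (Y x.2)
          + b • P x.2 (projN x u))
        - (Real.sinh (2 * x.1) * h.inner x.2 (projN x u) (Y x.2)
          + Real.cosh (2 * x.1) * h.inner x.2 (projN x u) (P x.2 (Y x.2))) • xiExt x := by
  apply (isInvertible_inner (hypMetric hP) x).injective
  ext1 w
  have dX := FiberBundle.mdifferentiableAt_extend I E (projN x u)
  have dZ := FiberBundle.mdifferentiableAt_extend I E (projN x w)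
  have k := inner_leviCivitaFun (hypMetric hP) (mdifferentiableAt_liftField (etaExt x u) dX)
    (mdifferentiableAt_liftField b hY) (mdifferentiableAt_liftField (etaExt x w) dZ)
  rw [koszul_liftField hP _ _ _ dX hY dZ, liftField_extend, liftField_extend,
    FiberBundle.extend_apply_self, FiberBundle.extend_apply_self] at k
  change (hypMetric hP).inner x (leviCivitaFun (hypMetric hP) (liftField b Y) x u) w = _
  rw [mul_left_cancel₀ two_ne_zero k, hypMetric_inner, metricExt]
  simp only [map_sub, map_smul, etaExt_inclN, projN_inclN, etaExt_xiExt, projN_xiExt, smul_zero,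
    sub_zero, smul_eq_mul]
  ring

omit [I.Boundaryless] in
-- The Leibniz terms `df(u) φY` of `∇_u(φ(fY))` and `φ(∇_u(fY))` cancel.
theorem tensorialAt_nablaEnd (g : RMetric I N)
    {φ : Π p : N, TangentSpace I p →L[ℝ] TangentSpace I p} (hφ : IsSmoothEndomorphism φ) (p : N)
    (u : TangentSpace I p) : TensorialAt I E (fun Y ↦ nablaEnd g φ p u Y) p where
  smul {f Y} hf hY := by
    have e : (fun q ↦ φ q ((f • Y) q)) = f • fun q ↦ φ q (Y q) := by
      ext q; simp
    have hc := (leviCivita g).isCovariantDerivativeOn (s := Set.univ)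
    simp only [nablaEnd, e, hc.leibniz hY hf (Set.mem_univ p),
      hc.leibniz (hφ.mdifferentiableAt_apply hY) hf (Set.mem_univ p)]
    simp [smul_sub]
  add {Y Y'} hY hY' := by
    have e : (fun q ↦ φ q ((Y + Y') q)) = (fun q ↦ φ q (Y q)) + fun q ↦ φ q (Y' q) := by
      ext q; simp
    have hc := (leviCivita g).isCovariantDerivativeOn (s := Set.univ)
    simp only [nablaEnd, e, hc.add hY hY' (Set.mem_univ p),
      hc.add (hφ.mdifferentiableAt_apply hY) (hφ.mdifferentiableAt_apply hY') (Set.mem_univ p)]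
    simp
    abel

/-- The covariant derivative of `φ` on `ℝ × N`. -/
theorem nablaEnd_phiExt (hP : IsParaholomorphic n P h) {x : ℝ × N}
    (u : TangentSpace (𝓘(ℝ).prod I) x) {Y : Π x : ℝ × N, TangentSpace (𝓘(ℝ).prod I) x}
    (hY : MDiffAt (T% Y) x) :
    nablaEnd (hypMetric hP) (phiExt P) x u Y
      = -(etaExt x (Y x) • inclN x (projN x u))
        - (metricExt P h x u (Y x) - etaExt x u * etaExt x (Y x)) • xiExt x := by
  have dZ := FiberBundle.mdifferentiableAt_extend I E (projN x (Y x))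
  have dPZ := hP.smooth.mdifferentiableAt_apply dZ
  have e := (tensorialAt_nablaEnd (hypMetric hP) (isSmoothEndomorphism_phiExt hP.smooth) x
    u).pointwise hY (mdifferentiableAt_liftField (etaExt x (Y x)) dZ) (liftField_extend x (Y x)).symm
  refine e.trans ?_
  simp only [nablaEnd, phiExt_liftField]
  rw [leviCivita_liftField hP _ dPZ, leviCivita_liftField hP _ dZ, hP.leviCivita_apply dZ]
  -- The terms `P ∇^h` cancel, and so do the two terms `η(u) P²`. What survives is `-η(Y) P²X`,
  -- together with the `ξ` component of `∇_u(φY)`, since `φξ = 0`.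
  simp only [FiberBundle.extend_apply_self, hP.sq, map_sub, map_add, map_smul, phiExt_inclN,
    phiExt_xiExt, metricExt]
  simp only [zero_smul, smul_zero, sub_zero, add_zero]
  module

theorem isParaSasakiLike_hypMetric (hP : IsParaholomorphic n P h) :
    IsParaSasakiLike n (phiExt P) xiExt etaExt (hypMetric hP) where
  toIsAlmostParacontactParacomplex := isAlmostParacontactParacomplex_hypMetric hP
  horizontal x u Y w hY hu hYx hw := by
    rw [structureTensor, nablaEnd_phiExt hP u hY, hypMetric_inner, metricExt]
    simp [hYx, hw]
  xi_horizontal x Y w hY hYx hw := by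
    rw [structureTensor, nablaEnd_phiExt hP _ hY, hypMetric_inner, metricExt]
    simp [hYx, hw]
  xi_xi x w hw := by
    rw [structureTensor, nablaEnd_phiExt hP _ ((isSmoothVectorField_xiExt I).mdifferentiableAt
      (by simp)), hypMetric_inner, metricExt]
    simp [hw]
  horizontal_xi x u Y hY hu hYx := by
    rw [structureTensor, nablaEnd_phiExt hP u hY, hypMetric_inner, hypMetric_inner, metricExt]
    simp [hYx, hu]

end Connection

/-! ### Riemannian length and distance as functions of the metric -/

section Distance

variable {E : Type*} [NormedAddCommGroup E] [NormedSpace ℝ E]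
  {H : Type*} [TopologicalSpace H] {I : ModelWithCorners ℝ E H}
  {M : Type*} [TopologicalSpace M] [ChartedSpace H M] [IsManifold I ∞ M]

/-- The Riemannian distance of a metric. -/
def metricEDist (g : RMetric I M) (p q : M) : ℝ≥0∞ :=
  letI : RiemannianBundle (fun x : M ↦ TangentSpace I x) := ⟨g.toRiemannianMetric⟩
  riemannianEDist I p q

/-- The length of a path on `[0, 1]` for a Riemannian metric. -/
def metricELength (g : RMetric I M) (γ : ℝ → M) : ℝ≥0∞ :=
  ∫⁻ t in Set.Ioo (0 : ℝ) 1, ENNReal.ofReal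
    √(g.inner (γ t) (mfderiv 𝓘(ℝ) I γ t (1 : ℝ)) (mfderiv 𝓘(ℝ) I γ t (1 : ℝ)))

/-- The explicit integrand lets lengths for two metrics be compared pointwise, with the norm
instance on tangent spaces kept local. -/
theorem pathELength_eq_metricELength (g : RMetric I M) (γ : ℝ → M) :
    letI : RiemannianBundle (fun x : M ↦ TangentSpace I x) := ⟨g.toRiemannianMetric⟩
    pathELength I γ 0 1 = metricELength g γ := by
  let : RiemannianBundle (fun x : M ↦ TangentSpace I x) := ⟨g.toRiemannianMetric⟩
  rw [pathELength_eq_lintegral_mfderiv_Ioo, metricELength]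
  refine MeasureTheory.lintegral_congr fun t ↦ ?_
  rw [← ofReal_norm, norm_eq_sqrt_real_inner]
  rfl

theorem metricEDist_le (g : RMetric I M) {γ : ℝ → M} {p q : M}
    (hγ : ContMDiffOn 𝓘(ℝ) I 1 γ (Set.Icc 0 1)) (h0 : γ 0 = p) (h1 : γ 1 = q) :
    metricEDist g p q ≤ metricELength g γ := by
  let : RiemannianBundle (fun x : M ↦ TangentSpace I x) := ⟨g.toRiemannianMetric⟩
  rw [← pathELength_eq_metricELength]
  exact riemannianEDist_le_pathELength hγ h0 h1 zero_le_one

theorem exists_of_metricEDist_lt (g : RMetric I M) {p q : M} {r : ℝ≥0∞}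
    (hr : metricEDist g p q < r) :
    ∃ γ : ℝ → M, γ 0 = p ∧ γ 1 = q ∧ ContMDiffOn 𝓘(ℝ) I 1 γ (Set.Icc 0 1) ∧
      metricELength g γ < r := by
  let : RiemannianBundle (fun x : M ↦ TangentSpace I x) := ⟨g.toRiemannianMetric⟩
  simp only [← pathELength_eq_metricELength]
  exact exists_lt_of_riemannianEDist_lt hr

theorem metricEDist_triangle (g : RMetric I M) (p q r : M) :
    metricEDist g p r ≤ metricEDist g p q + metricEDist g q r := by
  let : RiemannianBundle (fun x : M ↦ TangentSpace I x) := ⟨g.toRiemannianMetric⟩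
  exact riemannianEDist_triangle

theorem isCompleteMetric_iff (g : RMetric I M) : IsCompleteMetric g ↔ ∀ p : ℕ → M,
    (∀ ε : ℝ≥0∞, 0 < ε → ∃ m₀, ∀ m ≥ m₀, ∀ k ≥ m₀, metricEDist g (p m) (p k) < ε) →
    ∃ q : M, Filter.Tendsto (fun m ↦ metricEDist g (p m) q) Filter.atTop (𝓝 0) :=
  Iff.rfl

end Distance

/-! ### Comparison of distances and completeness -/

section Completeness

variable {E : Type*} [NormedAddCommGroup E] [NormedSpace ℝ E]
  {H : Type*} [TopologicalSpace H] {I : ModelWithCorners ℝ E H}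
  {N : Type*} [TopologicalSpace N] [ChartedSpace H N]

theorem mfderiv_fst_comp {γ : ℝ → ℝ × N} {s : ℝ}
    (hγ : MDifferentiableAt 𝓘(ℝ) (𝓘(ℝ).prod I) γ s) :
    deriv (fun t ↦ (γ t).1) s = etaExt (γ s) (mfderiv 𝓘(ℝ) (𝓘(ℝ).prod I) γ s (1 : ℝ)) := by
  have h := mfderiv_comp_apply (I'' := 𝓘(ℝ)) s (mdifferentiableAt_fst (x := γ s)) hγ (1 : ℝ)
  rw [mfderiv_eq_fderiv] at h
  exact h

theorem mfderiv_snd_comp {γ : ℝ → ℝ × N} {s : ℝ}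
    (hγ : MDifferentiableAt 𝓘(ℝ) (𝓘(ℝ).prod I) γ s) :
    mfderiv 𝓘(ℝ) I (fun t ↦ (γ t).2) s (1 : ℝ)
      = projN (γ s) (mfderiv 𝓘(ℝ) (𝓘(ℝ).prod I) γ s (1 : ℝ)) :=
  mfderiv_comp_apply (I'' := I) s (mdifferentiableAt_snd (x := γ s)) hγ (1 : ℝ)

theorem exp_abs_sq (t : ℝ) : Real.exp |t| ^ 2 = Real.exp |2 * t| := by
  rw [← Real.exp_nat_mul, abs_mul]
  simp

variable [IsManifold I ∞ N] [FiniteDimensional ℝ E] {n : ℕ}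
  {P : Π p : N, TangentSpace I p →L[ℝ] TangentSpace I p} {h : RMetric I N}

/-- The slice part of `g` is nonnegative. This is what makes `t` 1-Lipschitz. -/
theorem IsParaholomorphic.abs_etaExt_le_sqrt (hP : IsParaholomorphic n P h) (x : ℝ × N)
    (u : TangentSpace (𝓘(ℝ).prod I) x) :
    |etaExt x u| ≤ √((hypMetric hP).inner x u u) := by
  refine Real.abs_le_sqrt ?_
  have := hP.le_metricExt x u
  have := mul_nonneg (Real.exp_pos (-|2 * x.1|)).le (inner_self_nonneg h x.2 (projN x u))
  rw [hypMetric_inner]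
  linarith

theorem IsParaholomorphic.sqrt_inner_projN_le (hP : IsParaholomorphic n P h) (x : ℝ × N)
    (u : TangentSpace (𝓘(ℝ).prod I) x) :
    √(h.inner x.2 (projN x u) (projN x u)) ≤ Real.exp |x.1| * √((hypMetric hP).inner x u u) := by
  rw [hypMetric_inner, Real.sqrt_le_left (by positivity), mul_pow, exp_abs_sq,
    Real.sq_sqrt ((add_nonneg (sq_nonneg _) (mul_nonneg (Real.exp_pos _).le
      (inner_self_nonneg h x.2 _))).trans (hP.le_metricExt x u))]
  have h1 := hP.le_metricExt x u
  have h2 := mul_le_mul_of_nonneg_left h1 (Real.exp_pos |2 * x.1|).le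
  rw [mul_add, ← mul_assoc, ← Real.exp_add, add_neg_cancel, Real.exp_zero, one_mul] at h2
  have := mul_nonneg (Real.exp_pos |2 * x.1|).le (sq_nonneg (etaExt x u))
  linarith

theorem IsParaholomorphic.sqrt_inner_le (hP : IsParaholomorphic n P h) (x : ℝ × N)
    (u : TangentSpace (𝓘(ℝ).prod I) x) (hu : etaExt x u = 0) :
    √((hypMetric hP).inner x u u) ≤ Real.exp |x.1| * √(h.inner x.2 (projN x u) (projN x u)) := by
  rw [hypMetric_inner, Real.sqrt_le_left (by positivity), mul_pow, exp_abs_sq,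
    Real.sq_sqrt (inner_self_nonneg h x.2 _)]
  simpa [hu] using hP.metricExt_le x u

theorem mdifferentiableAt_of_mem_Ioo {F : Type*} [NormedAddCommGroup F] [NormedSpace ℝ F]
    {K : Type*} [TopologicalSpace K] {J : ModelWithCorners ℝ F K} {M : Type*} [TopologicalSpace M]
    [ChartedSpace K M] {γ : ℝ → M} (hγ : ContMDiffOn 𝓘(ℝ) J 1 γ (Set.Icc 0 1)) {s : ℝ}
    (hs : s ∈ Set.Ioo (0 : ℝ) 1) : MDifferentiableAt 𝓘(ℝ) J γ s :=
  (hγ.contMDiffAt (Icc_mem_nhds hs.1 hs.2)).mdifferentiableAt one_ne_zero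

/-- The bound is needed at every time `s`, not only at the endpoint, in order to confine a whole
short path to a slab `|t| ≤ R + 1`. -/
theorem ofReal_abs_fst_sub_le (hP : IsParaholomorphic n P h) {γ : ℝ → ℝ × N}
    (hγ : ContMDiffOn 𝓘(ℝ) (𝓘(ℝ).prod I) 1 γ (Set.Icc 0 1)) {s : ℝ} (hs : s ∈ Set.Icc (0 : ℝ) 1) :
    ENNReal.ofReal |(γ s).1 - (γ 0).1| ≤ metricELength (hypMetric hP) γ := by
  have hc : ContDiffOn ℝ 1 (fun t ↦ (γ t).1) (Set.Icc 0 1) :=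
    (contMDiff_fst.comp_contMDiffOn hγ).contDiffOn
  have h1 := enorm_sub_le_lintegral_deriv_of_contDiffOn_Icc
    (hc.mono (Set.Icc_subset_Icc_right hs.2)) hs.1
  rw [← ofReal_norm, Real.norm_eq_abs, MeasureTheory.restrict_Ioo_eq_restrict_Icc.symm] at h1
  refine h1.trans ((MeasureTheory.lintegral_mono_set (Set.Ioo_subset_Ioo_right hs.2)).trans ?_)
  refine MeasureTheory.setLIntegral_mono' measurableSet_Ioo fun t ht ↦ ?_
  rw [mfderiv_fst_comp (mdifferentiableAt_of_mem_Ioo hγ ht), ← ofReal_norm, Real.norm_eq_abs]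
  exact ENNReal.ofReal_le_ofReal (hP.abs_etaExt_le_sqrt _ _)

theorem ofReal_abs_sub_le_metricEDist (hP : IsParaholomorphic n P h) (x y : ℝ × N) :
    ENNReal.ofReal |y.1 - x.1| ≤ metricEDist (hypMetric hP) x y := by
  refine le_of_forall_gt fun r hr ↦ ?_
  obtain ⟨γ, rfl, rfl, hγ, hl⟩ := exists_of_metricEDist_lt _ hr
  exact (ofReal_abs_fst_sub_le hP hγ ⟨zero_le_one, le_rfl⟩).trans_lt hl

theorem metricELength_snd_le (hP : IsParaholomorphic n P h) {γ : ℝ → ℝ × N}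
    (hγ : ContMDiffOn 𝓘(ℝ) (𝓘(ℝ).prod I) 1 γ (Set.Icc 0 1)) {R : ℝ}
    (hR : ∀ s ∈ Set.Icc (0 : ℝ) 1, |(γ s).1| ≤ R) :
    metricELength h (fun t ↦ (γ t).2)
      ≤ ENNReal.ofReal (Real.exp R) * metricELength (hypMetric hP) γ := by
  rw [metricELength, metricELength, ← MeasureTheory.lintegral_const_mul' _ _ ENNReal.ofReal_ne_top]
  refine MeasureTheory.setLIntegral_mono' measurableSet_Ioo fun t ht ↦ ?_
  rw [mfderiv_snd_comp (mdifferentiableAt_of_mem_Ioo hγ ht),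
    ← ENNReal.ofReal_mul (Real.exp_pos R).le]
  refine ENNReal.ofReal_le_ofReal ((hP.sqrt_inner_projN_le _ _).trans ?_)
  exact mul_le_mul_of_nonneg_right (Real.exp_le_exp.2 (hR t ⟨ht.1.le, ht.2.le⟩))
    (Real.sqrt_nonneg _)

theorem metricEDist_snd_le (hP : IsParaholomorphic n P h) {x y : ℝ × N} {R : ℝ} (hx : |x.1| ≤ R)
    (hxy : metricEDist (hypMetric hP) x y < 1) :
    metricEDist h x.2 y.2
      ≤ ENNReal.ofReal (Real.exp (R + 1)) * metricEDist (hypMetric hP) x y := by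
  have key : ∀ r, metricEDist (hypMetric hP) x y < r → r ≤ 1 →
      metricEDist h x.2 y.2 ≤ ENNReal.ofReal (Real.exp (R + 1)) * r := by
    intro r hr hr1
    obtain ⟨γ, rfl, rfl, hγ, hl⟩ := exists_of_metricEDist_lt _ hr
    have hb : ∀ s ∈ Set.Icc (0 : ℝ) 1, |(γ s).1| ≤ R + 1 := by
      intro s hs
      have h1 := ((ofReal_abs_fst_sub_le hP hγ hs).trans hl.le).trans hr1
      rw [ENNReal.ofReal_le_one] at h1
      have := abs_sub_abs_le_abs_sub (γ s).1 (γ 0).1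
      linarith
    refine (metricEDist_le h (contMDiff_snd.comp_contMDiffOn hγ) rfl rfl).trans ?_
    exact (metricELength_snd_le hP hγ hb).trans (mul_le_mul_right hl.le _)
  have hc0 : ENNReal.ofReal (Real.exp (R + 1)) ≠ 0 := by
    simpa using Real.exp_pos (R + 1)
  rw [mul_comm, ← ENNReal.div_le_iff_le_mul (.inl hc0) (.inl ENNReal.ofReal_ne_top)]
  -- Any `r` above the distance may be lowered to some `r' < 1`, for which near-minimal paths stay
  -- in the slab.
  refine le_of_forall_gt fun r hr ↦ ?_
  obtain ⟨r', hr', hr''⟩ := exists_between (lt_min hr hxy)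
  refine lt_of_le_of_lt ?_ (hr''.trans_le (min_le_left _ _))
  rw [ENNReal.div_le_iff_le_mul (.inl hc0) (.inl ENNReal.ofReal_ne_top), mul_comm]
  exact key r' hr' (hr''.trans_le (min_le_right _ _)).le

/-- The straight segment has constant speed `|T - t|`, because `g(ξ, ξ) = 1`. -/
theorem metricEDist_vertical_le (hP : IsParaholomorphic n P h) (t T : ℝ) (q : N) :
    metricEDist (hypMetric hP) (t, q) (T, q) ≤ ENNReal.ofReal |T - t| := by
  let γ : ℝ → ℝ × N := fun s ↦ (t + s * (T - t), q)
  have hf : ContDiff ℝ 1 fun s : ℝ ↦ t + s * (T - t) := by fun_prop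
  have hγ : ContMDiff 𝓘(ℝ) (𝓘(ℝ).prod I) 1 γ := hf.contMDiff.prodMk contMDiff_const
  refine (metricEDist_le (hypMetric hP) hγ.contMDiffOn (by simp [γ]) (by simp [γ])).trans ?_
  have hl : ∀ s ∈ Set.Ioo (0 : ℝ) 1, ENNReal.ofReal √((hypMetric hP).inner (γ s)
      (mfderiv 𝓘(ℝ) (𝓘(ℝ).prod I) γ s (1 : ℝ)) (mfderiv 𝓘(ℝ) (𝓘(ℝ).prod I) γ s (1 : ℝ)))
      = ENNReal.ofReal |T - t| := by
    intro s _
    have hd : MDifferentiableAt 𝓘(ℝ) (𝓘(ℝ).prod I) γ s := hγ.mdifferentiableAt one_ne_zero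
    have e1 := mfderiv_fst_comp hd
    have e2 := mfderiv_snd_comp hd
    have d : HasDerivAt (fun s : ℝ ↦ t + s * (T - t)) (T - t) s := by
      simpa using ((hasDerivAt_id s).mul_const (T - t)).const_add t
    have d1 : deriv (fun s ↦ (γ s).1) s = T - t := d.deriv
    have d2 : mfderiv 𝓘(ℝ) I (fun s ↦ (γ s).2) s (1 : ℝ) = 0 := by
      simp only [γ, mfderiv_const]
      rfl
    rw [hypMetric_inner, metricExt, ← e1, ← e2, d1, d2]
    simp only [map_zero, mul_zero, add_zero]
    rw [Real.sqrt_mul_self_eq_abs]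
  rw [metricELength, MeasureTheory.setLIntegral_congr_fun measurableSet_Ioo hl]
  simp

/-- A path in `N` is copied into the slice `{T} × N`, where `g ≤ e^{2|T|} h`. -/
theorem metricEDist_horizontal_le (hP : IsParaholomorphic n P h) (T : ℝ) (p q : N) :
    metricEDist (hypMetric hP) (T, p) (T, q)
      ≤ ENNReal.ofReal (Real.exp |T|) * metricEDist h p q := by
  have hc0 : ENNReal.ofReal (Real.exp |T|) ≠ 0 := by
    simpa using Real.exp_pos |T|
  rw [mul_comm, ← ENNReal.div_le_iff_le_mul (.inl hc0) (.inl ENNReal.ofReal_ne_top)]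
  refine le_of_forall_gt fun r hr ↦ ?_
  obtain ⟨γ, rfl, rfl, hγ, hl⟩ := exists_of_metricEDist_lt _ hr
  refine lt_of_le_of_lt ?_ hl
  rw [ENNReal.div_le_iff_le_mul (.inl hc0) (.inl ENNReal.ofReal_ne_top), mul_comm]
  have hΓ : ContMDiffOn 𝓘(ℝ) (𝓘(ℝ).prod I) 1 (fun s ↦ (T, γ s)) (Set.Icc 0 1) :=
    contMDiffOn_const.prodMk hγ
  refine (metricEDist_le (hypMetric hP) hΓ rfl rfl).trans ?_
  rw [metricELength, metricELength, ← MeasureTheory.lintegral_const_mul' _ _ ENNReal.ofReal_ne_top]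
  refine MeasureTheory.setLIntegral_mono' measurableSet_Ioo fun s hs ↦ ?_
  have hd := mdifferentiableAt_of_mem_Ioo hΓ hs
  have e1 := mfderiv_fst_comp hd
  have e2 := mfderiv_snd_comp hd
  rw [deriv_const] at e1
  rw [← ENNReal.ofReal_mul (Real.exp_pos _).le]
  refine ENNReal.ofReal_le_ofReal ((hP.sqrt_inner_le _ _ e1.symm).trans ?_)
  rw [← e2]

theorem isCompleteMetric_hypMetric (hP : IsParaholomorphic n P h) (hc : IsCompleteMetric h) :
    IsCompleteMetric (hypMetric hP) := by
  rw [isCompleteMetric_iff] at hc ⊢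
  intro p hp
  have hcauchy : CauchySeq fun m ↦ (p m).1 := by
    rw [EMetric.cauchySeq_iff]
    intro ε hε
    obtain ⟨m₀, hm₀⟩ := hp ε hε
    refine ⟨m₀, fun m hm k hk ↦ ?_⟩
    rw [edist_comm, edist_dist, Real.dist_eq]
    exact (ofReal_abs_sub_le_metricEDist hP _ _).trans_lt (hm₀ m hm k hk)
  obtain ⟨T, hT⟩ := cauchySeq_tendsto_of_complete hcauchy
  obtain ⟨R, hR⟩ := hT.abs.bddAbove_range
  have hR' (m : ℕ) : |(p m).1| ≤ R := hR ⟨m, rfl⟩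
  obtain ⟨q, hq⟩ := hc (fun m ↦ (p m).2) fun ε hε ↦ by
    have hC0 : ENNReal.ofReal (Real.exp (R + 1)) ≠ 0 := by simpa using Real.exp_pos (R + 1)
    -- The `1` meets the smallness hypothesis of `metricEDist_snd_le`; the quotient absorbs its
    -- constant.
    obtain ⟨m₀, hm₀⟩ := hp (min 1 (ε / ENNReal.ofReal (Real.exp (R + 1))))
      (lt_min one_pos (ENNReal.div_pos hε.ne' ENNReal.ofReal_ne_top))
    refine ⟨m₀, fun m hm k hk ↦ ?_⟩
    have hd := hm₀ m hm k hk
    refine (metricEDist_snd_le hP (hR' m) (hd.trans_le (min_le_left _ _))).trans_lt ?_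
    rw [mul_comm]
    exact ENNReal.mul_lt_of_lt_div (hd.trans_le (min_le_right _ _))
  refine ⟨(T, q), ?_⟩
  have h1 : Filter.Tendsto (fun m ↦ ENNReal.ofReal |T - (p m).1|) Filter.atTop (𝓝 0) := by
    have := ENNReal.tendsto_ofReal (hT.const_sub T).abs
    simpa using this
  have h2 : Filter.Tendsto (fun m ↦ ENNReal.ofReal (Real.exp |T|) * metricEDist h (p m).2 q)
      Filter.atTop (𝓝 0) := by
    have := ENNReal.Tendsto.const_mul hq
      (.inr (ENNReal.ofReal_ne_top (r := Real.exp |T|)))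
    simpa using this
  have h3 := h1.add h2
  rw [add_zero] at h3
  refine tendsto_of_tendsto_of_tendsto_of_le_of_le tendsto_const_nhds h3 (fun _ ↦ zero_le)
    fun m ↦ ?_
  -- Moving vertically first puts the horizontal move in the slice `t = T`, so the factor `e^{|T|}`
  -- does not depend on `m`.
  exact (metricEDist_triangle _ _ (T, (p m).2) _).trans
    (add_le_add (metricEDist_vertical_le hP _ _ _) (metricEDist_horizontal_le hP _ _ _))

end Completeness

end ParaSasaki

end

theorem theorem2p4 (n : ℕ)
    {N : Type*} [TopologicalSpace N] [T2Space N]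
    [ChartedSpace (EuclideanSpace ℝ (Fin (2 * n))) N]
    [IsManifold 𝓘(ℝ, EuclideanSpace ℝ (Fin (2 * n))) ∞ N]
    (P : Π p : N, TangentSpace 𝓘(ℝ, EuclideanSpace ℝ (Fin (2 * n))) p →L[ℝ]
      TangentSpace 𝓘(ℝ, EuclideanSpace ℝ (Fin (2 * n))) p)
    (h : ParaSasaki.RMetric 𝓘(ℝ, EuclideanSpace ℝ (Fin (2 * n))) N)
    (hP : ParaSasaki.IsParaholomorphic n P h) :
    ∃ g : ParaSasaki.RMetric (𝓘(ℝ).prod 𝓘(ℝ, EuclideanSpace ℝ (Fin (2 * n)))) (ℝ × N),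
      (∀ x u v, g.inner x u v = ParaSasaki.metricExt P h x u v) ∧
      ParaSasaki.IsParaSasakiLike n (ParaSasaki.phiExt P) ParaSasaki.xiExt ParaSasaki.etaExt g ∧
      (ParaSasaki.IsCompleteMetric h → ParaSasaki.IsCompleteMetric g) := by
  exact ⟨ParaSasaki.hypMetric hP, ParaSasaki.hypMetric_inner hP,
    ParaSasaki.isParaSasakiLike_hypMetric hP, ParaSasaki.isCompleteMetric_hypMetric hP⟩
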